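/- **Theorem.** Let $H$ act on the vertices of a tree $T$ (with path metric $d$) in one of the following two situations: (a) $K$ is a non-archimedean local field with ring of integers $\mathcal O$, $H=\mathrm{SL}_2(K)$, and $T$ is the Bruhat–Tits tree of $K$ (its vertices are the homothety classes of $\mathcal O$-lattices in $K^2$, two classes being adjacent if they have representatives $L_0\subset L$ with $L/L_0\cong\mathcal O/\mathfrak m$, where $\mathfrak m$ is the maximal ideal of $\mathcal O$); (b) $T$ is a locally finite simplicial tree and $H=\mathrm{Isom}(T)$, the group of automorphisms of $T$ with the topology of pointwise convergence. Let $A,B\in H$ generate a subgroup $G=\langle A,B\rangle$ that is discrete and free of rank two, and let $C\in H$. For $g\in H$ put $l(g)=\min_x d(x,gx)$ over the vertices $x$ of $T$, and call $\{x: d(x,gx)=l(g)\}$ the axis of $g$ when $l(g)>0$. Let $F$ be the free group on $a,b$. Consider the following algorithm, in which the values of $l$, the equality of elements of $H$ and of vertices, and the membership of vertices in the sets below are available. 1. (Generators.) Set $X=A$, $Y=B$; fail if $l(X)=0$ or $l(Y)=0$. Repeat: swap $X$ and $Y$ if $l(X)>l(Y)$; put $m=\min\{l(XY),l(X^{-1}Y)\}$;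 fail if $m=0$; if $m\le l(Y)-l(X)$, replace $Y$ by an element of $\{XY,X^{-1}Y\}$ of translation length $m$ and repeat; otherwise stop with the pair $(X,Y)$. Keep $X=X(A,B)$ and $Y=Y(A,B)$ as words in $A,B$. 2. (Domain.) Choose midpoints $p$, $q$ of edges on the axes of $X$, $Y$ such that the interiors of the paths $[p,Xp]$ and $[q,Yq]$ contain the intersection of the two axes or, if the axes are disjoint, contain respectively the end $p'$ on the axis of $X$ and the end $q'$ on the axis of $Y$ of the path joining the axes. Let $U_-$ (resp. $U_+$) be the set of vertices of the component containing the part of the axis of $X$ before $p$ (resp. after $Xp$) when $T$ is cut at $p$ (resp. at $Xp$). Define $V_-$ and $V_+$ in the same way from $Y$, $q$, $Yq$. Let $D$ be the set of vertices of $T$ outside $U_+\cup U_-\cup V_+\cup V_-$, and choose $z'\in D$. 3. Set $w=1\in F$ and $z=Cz'$. 4. While $z\notin D$: if $z\in U_\pm$, replace $z$ by $X^{\mp1}z$ and $w$ by $wa^{\pm1}$; if $z\in V_\pm$, replace $z$ by $Y^{\mp1}z$ and $w$ by $wb^{\pm1}$. 5. If $w(X,Y)=C$ and $z=z'$, return true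 and the word $w(X(a,b),Y(a,b))\in F$; otherwise return false. Then, whatever choices are made, the algorithm terminates after finitely many steps, never fails and never gets stuck. If $C\in G$, it returns true and a word $w\in F$ with $w(A,B)=C$; if $C\notin G$, it returns false. Moreover, the pair $(X,Y)$ obtained in step 1 generates $G$, $l(X),l(Y)>0$, and the axes of $X$ and $Y$ are disjoint or meet along a path of length less than $\min\{l(X),l(Y)\}$. The set $D$ of step 2 is a fundamental domain for the action of $G$ on the vertices of $T$: the translates $gD$ ($g\in G$) cover the vertices of $T$ and are pairwise disjoint. -/

import Mathlib

open scoped ValuativeRel Pointwise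

noncomputable section

/-! ### Groups acting on the vertices of a simplicial tree

`T` is the graph underlying the tree, with path metric `T.dist`, and `H` acts on its vertices. -/

section TreeAction

variable {V : Type*} (T : SimpleGraph V) {H : Type*} [Group H] [MulAction H V]

/-- The translation length `l(g) = min_x d(x, g x)` over the vertices `x` of `T`. -/
def translationLength (g : H) : ℕ :=
  sInf (Set.range fun x : V => T.dist x (g • x))

/-- The vertices moved by exactly `l(g)`; for hyperbolic `g` these are the vertices of its axis. -/
def axis (g : H) : Set V :=
  {x | T.dist x (g • x) = translationLength T g}

/-- The hypotheses under which the Ping Pong Lemma is applied to `X` and `Y`: both are hyperbolic,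
and their axes are disjoint or meet along a path shorter than `min (l(X), l(Y))`. -/
def IsPingPongPair (X Y : H) : Prop :=
  0 < translationLength T X ∧ 0 < translationLength T Y ∧
    ∀ c ∈ axis T X ∩ axis T Y, ∀ d ∈ axis T X ∩ axis T Y,
      T.dist c d < min (translationLength T X) (translationLength T Y)

/-- `e = (e₁, e₂)` is an edge of the axis of `g`, and `g` translates in the direction from `e₁`
to `e₂`. The midpoint of such an edge is the cut point `p` on the axis. -/
def IsForwardEdge (g : H) (e : V × V) : Prop :=
  e.1 ∈ axis T g ∧ e.2 ∈ axis T g ∧ T.Adj e.1 e.2 ∧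
    T.dist e.2 (g • e.1) + 1 = translationLength T g

/-- The vertices of the maximal subtree that contains the vertices of the axis before the midpoint
`p` of the edge `e` and no other vertices of the axis: the component, containing `e₁`, of the
tree without the edge `e`. This is `U₋`. -/
def backwardSubtree (e : V × V) : Set V :=
  {x | T.dist x e.1 < T.dist x e.2}

/-- The vertices of the maximal subtree that contains the vertices of the axis after `g p` and no
other vertices of the axis, where `p` is the midpoint of the edge `e`: the component, containing
`g e₂`, of the tree without the edge `g e`. This is `U₊`. -/
def forwardSubtree (g : H) (e : V × V) : Set V :=
  {x | T.dist x (g • e.2) < T.dist x (g • e.1)}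

/-- `p'` on the axis of `X` and `q'` on the axis of `Y` realise the distance between the axes.
For disjoint axes in a tree there is one such pair, the ends of the path joining the axes; for
axes that meet, these are the pairs `(c, c)` with `c` on both axes. -/
def IsBridge (X Y : H) (p' q' : V) : Prop :=
  p' ∈ axis T X ∧ q' ∈ axis T Y ∧ ∀ a ∈ axis T X, ∀ b ∈ axis T Y, T.dist p' q' ≤ T.dist a b

/-- Admissible cut points: `p`, `q` are midpoints of the edges `e`, `f` of the axes of `X`, `Y`, and
the paths from `p` to `X p` and from `q` to `Y q` contain in their interiors the ends `p'`, `q'` of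
the path joining the axes, respectively the whole intersection of the axes. -/
def IsCut (X Y : H) (e f : V × V) : Prop :=
  IsForwardEdge T X e ∧ IsForwardEdge T Y f ∧
    ∀ p' q' : V, IsBridge T X Y p' q' →
      p' ∉ backwardSubtree T e ∧ p' ∉ forwardSubtree T X e ∧
      q' ∉ backwardSubtree T f ∧ q' ∉ forwardSubtree T Y f

/-- The vertices of `D = T \ (U₊ ∪ U₋ ∪ V₊ ∪ V₋)`. -/
def pingPongDomain (X Y : H) (e f : V × V) : Set V :=
  (forwardSubtree T X e ∪ backwardSubtree T e ∪
    (forwardSubtree T Y f ∪ backwardSubtree T f))ᶜ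

/-- `D` is a fundamental domain for the action of `G` on the vertices of the tree: the translates
of `D` by the elements of `G` cover, and translates by distinct elements are disjoint. -/
def IsVertexFundamentalDomain (G : Subgroup H) (D : Set V) : Prop :=
  (∀ x : V, ∃ g ∈ G, x ∈ g • D) ∧
    ∀ g ∈ G, ∀ h ∈ G, g ≠ h → Disjoint (g • D) (h • D)

end TreeAction

/-! ### The constructive membership algorithm -/

/-- Words in two letters `a`, `b`: the free group `F` of rank two. -/
abbrev Word := FreeGroup (Fin 2)

/-- The letter `a`. -/
def Word.a : Word := FreeGroup.of 0

/-- The letter `b`. -/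
def Word.b : Word := FreeGroup.of 1

/-- The value `w(A, B)` of the word `w = w(a, b)` at two elements of a group. -/
def Word.eval {H : Type*} [Group H] (A B : H) (w : Word) : H :=
  FreeGroup.lift ![A, B] w

/-- The states of the algorithm. The current generators `X`, `Y` are stored as the words `x`, `y`
in the input generators with `X = x(A, B)` and `Y = y(A, B)`. -/
inductive State (V : Type*)
  /-- The initial state. -/
  | start
  /-- Order the generators by translation length. -/
  | order (x y : Word)
  /-- Compare `m = min (l(XY), l(X⁻¹Y))` with `0` and with `l(Y) - l(X)`. -/
  | compare (x y : Word)
  /-- The reduction of the generators returned false: no suitable generators were obtained. -/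
  | abort
  /-- The reduction of the generators returned true and the pair `(X, Y)`. -/
  | generators (x y : Word)
  /-- The while loop, with the domain `D` given by the cut edges `e`, `f`, the base vertex `z'`, the
  current word `w` and the current vertex `z`. -/
  | loop (x y : Word) (e f : V × V) (z' : V) (w : Word) (z : V)
  /-- The algorithm has stopped: `some w` means true together with the word `w`, and `none`
  means false. -/
  | answer (r : Option Word)

section Algorithm

variable {V : Type*} (T : SimpleGraph V) {H : Type*} [Group H] [MulAction H V]

/-- One step of the algorithm with input generators `A`, `B` and input element `C`. Where the
algorithm leaves a choice, every admissible choice is a step. -/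
inductive Step (A B C : H) : State V → State V → Prop
  | start_abort (h : translationLength T A = 0 ∨ translationLength T B = 0) :
      Step A B C .start .abort
  | start_order (hA : translationLength T A ≠ 0) (hB : translationLength T B ≠ 0) :
      Step A B C .start (.order Word.a Word.b)
  | order_swap (x y : Word)
      (h : translationLength T (y.eval A B) < translationLength T (x.eval A B)) :
      Step A B C (.order x y) (.compare y x)
  | order_keep (x y : Word)
      (h : translationLength T (x.eval A B) ≤ translationLength T (y.eval A B)) :
      Step A B C (.order x y) (.compare x y)
  | compare_abort (x y : Word)
      (h : min (translationLength T ((x * y).eval A B))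
        (translationLength T ((x⁻¹ * y).eval A B)) = 0) :
      Step A B C (.compare x y) .abort
  | compare_replace (x y y' : Word) (m : ℕ)
      (hm : m = min (translationLength T ((x * y).eval A B))
        (translationLength T ((x⁻¹ * y).eval A B)))
      (h0 : m ≠ 0)
      (hle : (m : ℤ) ≤
        (translationLength T (y.eval A B) : ℤ) - (translationLength T (x.eval A B) : ℤ))
      (hy' : y' = x * y ∨ y' = x⁻¹ * y)
      (hl : translationLength T (y'.eval A B) = m) :
      Step A B C (.compare x y) (.order x y')
  | compare_done (x y : Word) (m : ℕ)
      (hm : m = min (translationLength T ((x * y).eval A B))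
        (translationLength T ((x⁻¹ * y).eval A B)))
      (h0 : m ≠ 0)
      (hlt : (translationLength T (y.eval A B) : ℤ) - (translationLength T (x.eval A B) : ℤ) <
        (m : ℤ)) :
      Step A B C (.compare x y) (.generators x y)
  | choose_domain (x y : Word) (e f : V × V) (z' : V)
      (hcut : IsCut T (x.eval A B) (y.eval A B) e f)
      (hz' : z' ∈ pingPongDomain T (x.eval A B) (y.eval A B) e f) :
      Step A B C (.generators x y) (.loop x y e f z' 1 (C • z'))
  | loop_forward_left (x y : Word) (e f : V × V) (z' : V) (w : Word) (z : V)
      (hz : z ∈ forwardSubtree T (x.eval A B) e) :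
      Step A B C (.loop x y e f z' w z)
        (.loop x y e f z' (w * Word.a) ((x.eval A B)⁻¹ • z))
  | loop_backward_left (x y : Word) (e f : V × V) (z' : V) (w : Word) (z : V)
      (hz : z ∈ backwardSubtree T e) :
      Step A B C (.loop x y e f z' w z)
        (.loop x y e f z' (w * Word.a⁻¹) (x.eval A B • z))
  | loop_forward_right (x y : Word) (e f : V × V) (z' : V) (w : Word) (z : V)
      (hz : z ∈ forwardSubtree T (y.eval A B) f) :
      Step A B C (.loop x y e f z' w z)
        (.loop x y e f z' (w * Word.b) ((y.eval A B)⁻¹ • z))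
  | loop_backward_right (x y : Word) (e f : V × V) (z' : V) (w : Word) (z : V)
      (hz : z ∈ backwardSubtree T f) :
      Step A B C (.loop x y e f z' w z)
        (.loop x y e f z' (w * Word.b⁻¹) (y.eval A B • z))
  | answer_true (x y : Word) (e f : V × V) (z' : V) (w : Word) (z : V)
      (hz : z ∈ pingPongDomain T (x.eval A B) (y.eval A B) e f)
      (h : w.eval (x.eval A B) (y.eval A B) = C ∧ z = z') :
      Step A B C (.loop x y e f z' w z) (.answer (some (w.eval x y)))
  | answer_false (x y : Word) (e f : V × V) (z' : V) (w : Word) (z : V)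
      (hz : z ∈ pingPongDomain T (x.eval A B) (y.eval A B) e f)
      (h : ¬ (w.eval (x.eval A B) (y.eval A B) = C ∧ z = z')) :
      Step A B C (.loop x y e f z' w z) (.answer none)

/-- The algorithm can reach the state `s` from its initial state. -/
def Reachable (A B C : H) (s : State V) : Prop :=
  Relation.ReflTransGen (Step T A B C) .start s

/-- On the input `A`, `B`, `C` the algorithm terminates after finitely many steps, whatever choices
are made, and produces the correct output. -/
structure TerminatesCorrectly (A B C : H) : Prop where
  /-- There is no infinite run. -/
  no_infinite_run : ∀ s : ℕ → State V, s 0 = .start → ∃ n, ¬ Step T A B C (s n) (s (n + 1))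
  /-- A run stops only by giving an answer. -/
  stops_at_answer : ∀ s : State V, Reachable T A B C s →
    (∃ s', Step T A B C s s') ∨ ∃ r, s = .answer r
  /-- If `C` lies in `⟨A, B⟩`, every answer is true with a word representing `C`. -/
  answer_of_mem : C ∈ Subgroup.closure {A, B} → ∀ r, Reachable T A B C (.answer r) →
    ∃ w : Word, r = some w ∧ w.eval A B = C
  /-- If `C` does not lie in `⟨A, B⟩`, every answer is false. -/
  answer_of_not_mem : C ∉ Subgroup.closure {A, B} → ∀ r, Reachable T A B C (.answer r) →
    r = none
  /-- The pair `(X, Y)` that is found generates `⟨A, B⟩` and satisfies the ping-pong hypotheses. -/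
  generators_spec : ∀ x y : Word, Reachable T A B C (.generators x y) →
    Subgroup.closure {x.eval A B, y.eval A B} = Subgroup.closure {A, B} ∧
      IsPingPongPair T (x.eval A B) (y.eval A B)
  /-- The domain `D` that is used is a fundamental domain for `⟨A, B⟩`. -/
  domain_spec : ∀ (x y : Word) (e f : V × V) (z' : V) (w : Word) (z : V),
    Reachable T A B C (.loop x y e f z' w z) →
      IsVertexFundamentalDomain (Subgroup.closure {A, B})
        (pingPongDomain T (x.eval A B) (y.eval A B) e f)

end Algorithm

/-- The subgroup `G` is free of rank two. -/
def IsFreeOfRankTwo {H : Type*} [Group H] (G : Subgroup H) : Prop :=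
  Nonempty (FreeGroup (Fin 2) ≃* G)

/-! ### Isometries of a simplicial tree -/

section Isometries

variable {V : Type*} {T : SimpleGraph V}

variable (T) in
/-- Isometries of the tree are the automorphisms of the graph `T`. This is the topology of
pointwise convergence on the isometry group, the vertex set being a discrete metric space. -/
@[reducible]
def pointwiseTopology : TopologicalSpace (T ≃g T) :=
  TopologicalSpace.induced (fun (g : T ≃g T) (x : V) => g x)
    (@Pi.topologicalSpace V (fun _ => V) (fun _ => ⊥))

/-- The subgroup `G` is discrete in the topology of pointwise convergence. -/
def IsPointwiseDiscrete (G : Subgroup (T ≃g T)) : Prop :=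
  @DiscreteTopology G (TopologicalSpace.induced Subtype.val (pointwiseTopology T))

end Isometries

/-! ### The Bruhat-Tits tree -/

section BruhatTits

variable (K : Type*) [Field K] [ValuativeRel K]

/-- Lattices in `K²`: finitely generated `𝒪`-submodules that span `K²` over `K`; over a discrete
valuation ring `𝒪` these are the free `𝒪`-submodules of rank two. -/
abbrev Lattice2 : Type _ :=
  {L : Submodule 𝒪[K] (Fin 2 → K) // L.IsLattice K}

/-- Two lattices are equivalent if `L = x L'` for some `x ∈ Kˣ`. -/
def latticeSetoid : Setoid (Lattice2 K) where
  r L L' := ∃ x : Kˣ, L.1 = x • L'.1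
  iseqv :=
    { refl := fun L => ⟨1, (one_smul _ _).symm⟩
      symm := by
        rintro L L' ⟨x, h⟩
        exact ⟨x⁻¹, by rw [h, inv_smul_smul]⟩
      trans := by
        rintro L L' L'' ⟨x, h⟩ ⟨y, h'⟩
        exact ⟨x * y, by rw [h, h', mul_smul]⟩ }

/-- The vertices of the Bruhat-Tits tree: equivalence classes of lattices. -/
def BTVertex : Type _ := Quotient (latticeSetoid K)

/-- The vertex represented by a lattice. -/
def BTVertex.mk (L : Lattice2 K) : BTVertex K := Quotient.mk (latticeSetoid K) L

/-- The Bruhat-Tits tree: the vertices `u ≠ v` are joined by an edge if they are represented by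
lattices `L` and `L₀ ⊆ L` with `L / L₀` isomorphic to `𝒪 / 𝓂` as an `𝒪`-module (in this order or
the other). -/
def bruhatTitsTree : SimpleGraph (BTVertex K) :=
  SimpleGraph.fromRel fun u v =>
    ∃ L L₀ : Lattice2 K, BTVertex.mk K L = u ∧ BTVertex.mk K L₀ = v ∧ L₀.1 ≤ L.1 ∧
      Nonempty ((L.1 ⧸ L₀.1.submoduleOf L.1) ≃ₗ[𝒪[K]] (𝒪[K] ⧸ 𝓂[K]))

variable {K}

/-- A matrix `g` in `SL₂(K)` sends a lattice `L` to the lattice `g L`. -/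
def latticeMap (g : Matrix.SpecialLinearGroup (Fin 2) K) (L : Lattice2 K) : Lattice2 K :=
  ⟨L.1.map ((Matrix.SpecialLinearGroup.toLin' g).toLinearMap.restrictScalars 𝒪[K]),
    { fg := L.2.fg.map _
      span_eq_top := by
        have h := L.2.span_eq_top
        have h2 : ((L.1.map ((Matrix.SpecialLinearGroup.toLin' g).toLinearMap.restrictScalars
            𝒪[K]) : Submodule 𝒪[K] (Fin 2 → K)) : Set (Fin 2 → K)) =
            (Matrix.SpecialLinearGroup.toLin' g).toLinearMap '' (L.1 : Set (Fin 2 → K)) := rfl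
        rw [h2, Submodule.span_image, h, Submodule.map_top, LinearEquiv.range] }⟩

theorem latticeMap_rel (g : Matrix.SpecialLinearGroup (Fin 2) K) (L L' : Lattice2 K)
    (h : latticeSetoid K L L') : latticeSetoid K (latticeMap g L) (latticeMap g L') := by
  obtain ⟨x, hx⟩ := h
  refine ⟨x, ?_⟩
  apply SetLike.coe_injective
  change (Matrix.SpecialLinearGroup.toLin' g) '' (L.1 : Set (Fin 2 → K)) =
    x • ((Matrix.SpecialLinearGroup.toLin' g) '' (L'.1 : Set (Fin 2 → K)))
  rw [hx]
  change (Matrix.SpecialLinearGroup.toLin' g) '' (x • (L'.1 : Set (Fin 2 → K))) = _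
  exact Set.image_smul_comm _ _ _ (fun v => (Matrix.SpecialLinearGroup.toLin' g).map_smul (x : K) v)

/-- The action of `SL₂(K)` on the vertices of the Bruhat-Tits tree, `g [L] = [g L]`. -/
instance btAction : MulAction (Matrix.SpecialLinearGroup (Fin 2) K) (BTVertex K) where
  smul g := Quotient.map (latticeMap g) (latticeMap_rel g)
  one_smul u := by
    induction u using Quotient.inductionOn with
    | _ L =>
      refine congrArg (Quotient.mk _) (Subtype.ext (SetLike.coe_injective ?_))
      change (Matrix.SpecialLinearGroup.toLin' (1 : Matrix.SpecialLinearGroup (Fin 2) K)) ''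
        (L.1 : Set (Fin 2 → K)) = L.1
      rw [map_one]
      exact Set.image_id _
  mul_smul g h u := by
    induction u using Quotient.inductionOn with
    | _ L =>
      refine congrArg (Quotient.mk _) (Subtype.ext (SetLike.coe_injective ?_))
      change (Matrix.SpecialLinearGroup.toLin' (g * h)) '' (L.1 : Set (Fin 2 → K)) =
        (Matrix.SpecialLinearGroup.toLin' g) '' ((Matrix.SpecialLinearGroup.toLin' h) ''
          (L.1 : Set (Fin 2 → K)))
      rw [map_mul, Set.image_image]
      rfl

end BruhatTits

end

/-! Discreteness makes the vertex stabilisers in `G` finite, and a free group has no torsion. So `G`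
acts freely and inverts no edge, and every nontrivial element of `G` is hyperbolic with a geodesic
line as axis (`exists_axisLine`). As `G` is not commutative, `X`, `Y`, `XY` and `X⁻¹Y` are
nontrivial for every generating pair, so the tests for length zero never fail.

Let `l(X) ≤ l(Y)`. If the axes share a path of length at least `l(X)`, then `XY` or `X⁻¹Y` cancels a
whole period of `X` and moves some vertex by only `l(Y) - l(X)` (`AxisPair.exists_short`). Hence a
pair on which step 1 stops satisfies the ping-pong hypotheses, while every replacement lowers `l(X)
+ l(Y)`.

The projections `P`, `Q` to the axes serve as integer coordinates: `X` adds `l(X)` to `P`, `Y` adds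
`l(Y)` to `Q`, and `U₊`, `U₋`, `V₊`, `V₋` become inequalities. Each vertex projects to an end of a
shortest path between the axes on at least one of them (`AxisPair.exists_bridge_proj`), so these
four sets are disjoint. By ping-pong a nontrivial reduced word maps `D` off itself. Conversely each
step of the loop lowers the distance to `D` (`CutPair.setDist_forward`, `CutPair.setDist_backward`),
so the loop ends and the translates of `D` cover. The loop keeps `w(X, Y) z = C z'`; if it stops
with `z ∈ D` and `C ∈ G`, then `w(X, Y)⁻¹ C` maps `z' ∈ D` into `D`, which forces `w(X, Y) = C` and
`z = z'`.

Both situations reduce to `ActsFreely.terminatesCorrectly`. For `SL₂(K)` the graph of lattice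
classes must also be shown to be a tree. By elementary divisors a class has a level `n` relative to
a lattice with basis `(e, f)`, being represented by `(e, ϖ ^ n f)` for a suitable such basis; each
class of positive level has exactly one lower neighbour. -/

/-! ### Metric description of trees -/

section TreeLike

variable {V : Type*} {T : SimpleGraph V}

/-- The metric properties of trees that are used below. -/
structure IsMetricTree (T : SimpleGraph V) : Prop where
  connected : T.Connected
  dist_ne_of_adj : ∀ {a b : V}, T.Adj a b → ∀ x, T.dist x a ≠ T.dist x b
  eq_of_closer : ∀ {x y u w : V}, T.Adj y u → T.Adj y w → T.dist x u < T.dist x y →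
    T.dist x w < T.dist x y → u = w

theorem SimpleGraph.Connected.dist_le_succ_of_adj (h : T.Connected) {a b : V} (hab : T.Adj a b)
    (x : V) : T.dist x b ≤ T.dist x a + 1 := by
  have := h.dist_triangle (u := x) (v := a) (w := b)
  rwa [SimpleGraph.dist_eq_one_iff_adj.2 hab] at this

theorem SimpleGraph.IsTree.length_eq_dist (h : T.IsTree) {a b : V} (p : T.Walk a b)
    (hp : p.IsPath) : p.length = T.dist a b := by
  obtain ⟨q, hq, hl⟩ := h.connected.exists_path_of_dist a b
  rw [← hl]
  exact congrArg SimpleGraph.Walk.length (congrArg Subtype.val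
    ((h.isAcyclic.subsingleton_path a b).elim ⟨p, hp⟩ ⟨q, hq⟩))

/-- Everything follows from uniqueness of paths. A geodesic to `a` that avoids `b` extends to the
path to `b`. A geodesic from `x` to a closer neighbour of `y` extends to the path from `x` to `y`,
whose last but one vertex is determined. -/
theorem SimpleGraph.IsTree.isMetricTree (h : T.IsTree) : IsMetricTree T where
  connected := h.connected
  dist_ne_of_adj := by
    intro a b hab x heq
    obtain ⟨p, hp, hl⟩ := h.connected.exists_path_of_dist x a
    classical
    by_cases hb : b ∈ p.support
    · have h1 := p.take_spec hb
      have h2 := congrArg SimpleGraph.Walk.length h1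
      rw [SimpleGraph.Walk.length_append] at h2
      have h3 := SimpleGraph.dist_le (p.takeUntil b hb)
      have h4 := SimpleGraph.dist_le (p.dropUntil b hb)
      rw [SimpleGraph.dist_eq_one_iff_adj.2 hab.symm] at h4
      omega
    · have := h.length_eq_dist (p.concat hab) (hp.concat hb hab)
      rw [SimpleGraph.Walk.length_concat] at this
      omega
  eq_of_closer := by
    have key : ∀ {x y u : V}, T.Adj y u → T.dist x u < T.dist x y →
        ∃ p : T.Walk x u, ∀ h : T.Adj u y, (p.concat h).IsPath := by
      intro x y u hyu hlt
      obtain ⟨p, hp, hl⟩ := h.connected.exists_path_of_dist x u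
      refine ⟨p, fun h => hp.concat (fun hy => ?_) h⟩
      classical
      have h2 := congrArg SimpleGraph.Walk.length (p.take_spec hy)
      rw [SimpleGraph.Walk.length_append] at h2
      have h3 := SimpleGraph.dist_le (p.takeUntil y hy)
      omega
    intro x y u w hu hw hxu hxw
    obtain ⟨p, hp⟩ := key hu hxu
    obtain ⟨q, hq⟩ := key hw hxw
    have := congrArg Subtype.val
      ((h.isAcyclic.subsingleton_path x y).elim ⟨_, hp hu.symm⟩ ⟨_, hq hw.symm⟩)
    exact (SimpleGraph.Walk.concat_inj this).1

namespace IsMetricTree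

variable (hT : IsMetricTree T)
include hT

theorem dist_eq_add_one_or {a b : V} (hab : T.Adj a b) (x : V) :
    T.dist x b = T.dist x a + 1 ∨ T.dist x a = T.dist x b + 1 := by
  have h1 := hT.connected.dist_le_succ_of_adj hab x
  have h2 := hT.connected.dist_le_succ_of_adj hab.symm x
  have h3 := hT.dist_ne_of_adj hab x
  omega

theorem exists_closer {x y : V} (h : x ≠ y) : ∃ u, T.Adj y u ∧ T.dist x y = T.dist x u + 1 := by
  obtain ⟨p, hl⟩ := hT.connected.exists_walk_length_eq_dist y x
  cases p with
  | nil => exact absurd rfl h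
  | cons hadj q =>
    rename_i u
    refine ⟨u, hadj, ?_⟩
    have h1 := SimpleGraph.dist_le q
    have h2 := hT.connected.dist_le_succ_of_adj hadj.symm x
    rw [SimpleGraph.Walk.length_cons] at hl
    rw [SimpleGraph.dist_comm] at hl h1
    omega

/-- Vertices on different sides of an edge are joined by a path through this edge. -/
theorem dist_eq_of_adj {x y a b : V} (hab : T.Adj a b) (hx : T.dist x a < T.dist x b)
    (hy : T.dist y b < T.dist y a) : T.dist x y = T.dist x a + 1 + T.dist b y := by
  induction hn : T.dist x a generalizing a b with
  | zero =>
    obtain rfl := hT.connected.dist_eq_zero_iff.1 hn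
    have := hT.dist_eq_add_one_or hab y
    rw [SimpleGraph.dist_comm, SimpleGraph.dist_comm (u := b)]
    omega
  | succ n ih =>
    have hne : x ≠ a := by rintro rfl; simp at hn
    obtain ⟨u, hau, hu⟩ := hT.exists_closer hne
    -- The edge is moved one step towards `x`. Since `b` is the only neighbour of `a` closer to `y`,
    -- the edge from `u` to `a` still separates `x` from `y`.
    have h1 : T.dist y a < T.dist y u := by
      rcases hT.dist_eq_add_one_or hau y with h | h
      · omega
      · obtain rfl : b = u := hT.eq_of_closer hab hau hy (by omega)
        omega
    have h2 := ih hau.symm (by omega) h1 (by omega)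
    have h3 := hT.dist_eq_add_one_or hab y
    rw [h2, SimpleGraph.dist_comm, SimpleGraph.dist_comm (u := b)]
    omega

/-- Distances to adjacent vertices differ by exactly one, so the distance from `x` rises on both
sides of a local minimum. It cannot turn down again: at a peak both neighbours on the path would be
closer to `x`, hence equal, which is backtracking. -/
theorem eq_add_natAbs_of_path {γ : ℤ → V} (hadj : ∀ i, T.Adj (γ i) (γ (i + 1)))
    (hne : ∀ i, γ i ≠ γ (i + 2)) {x : V} {i : ℤ}
    (hl : T.dist x (γ i) ≤ T.dist x (γ (i - 1)))
    (hr : T.dist x (γ i) ≤ T.dist x (γ (i + 1))) (j : ℤ) :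
    T.dist x (γ j) = T.dist x (γ i) + (j - i).natAbs := by
  have up : ∀ k : ℕ, T.dist x (γ (i + k)) = T.dist x (γ i) + k ∧
      T.dist x (γ (i + k + 1)) = T.dist x (γ i) + k + 1 := by
    intro k
    induction k with
    | zero =>
      have := hT.dist_eq_add_one_or (hadj i) x
      simp
      omega
    | succ k ih =>
      obtain ⟨h1, h2⟩ := ih
      have e1 : i + ((k + 1 : ℕ) : ℤ) = i + k + 1 := by push_cast; ring
      rw [e1]
      refine ⟨by omega, ?_⟩
      rcases hT.dist_eq_add_one_or (hadj (i + k + 1)) x with h | h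
      · omega
      · exfalso
        have := hT.eq_of_closer (x := x) (hadj (i + k)).symm (hadj (i + k + 1))
          (by omega) (by omega)
        exact hne (i + k) (by rw [this]; ring_nf)
  have down : ∀ k : ℕ, T.dist x (γ (i - k)) = T.dist x (γ i) + k ∧
      T.dist x (γ (i - k - 1)) = T.dist x (γ i) + k + 1 := by
    intro k
    induction k with
    | zero =>
      have h := hadj (i - 1)
      rw [sub_add_cancel] at h
      have := hT.dist_eq_add_one_or h x
      simp
      omega
    | succ k ih =>
      obtain ⟨h1, h2⟩ := ih
      have e1 : i - ((k + 1 : ℕ) : ℤ) = i - k - 1 := by push_cast; ring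
      rw [e1]
      refine ⟨by omega, ?_⟩
      have a1 := hadj (i - k - 1)
      have a2 := hadj (i - k - 1 - 1)
      rw [sub_add_cancel] at a1 a2
      rcases hT.dist_eq_add_one_or a2 x with h | h
      · exfalso
        have := hT.eq_of_closer (x := x) a1 a2.symm (by omega) (by omega)
        exact hne (i - k - 1 - 1) (by rw [← this]; ring_nf)
      · omega
  rcases le_total i j with h | h
  · have := (up (j - i).toNat).1
    rw [show i + ((j - i).toNat : ℤ) = j by omega] at this
    omega
  · have := (down (i - j).toNat).1
    rw [show i - ((i - j).toNat : ℤ) = j by omega] at this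
    omega

/-- A path without backtracking is a geodesic. -/
theorem dist_of_path {γ : ℤ → V} (hadj : ∀ i, T.Adj (γ i) (γ (i + 1)))
    (hne : ∀ i, γ i ≠ γ (i + 2)) (i j : ℤ) : T.dist (γ i) (γ j) = (j - i).natAbs := by
  simpa using hT.eq_add_natAbs_of_path hadj hne (x := γ i) (i := i) (by simp) (by simp) j

end IsMetricTree

/-- `γ` is a geodesic line. -/
def IsLine (T : SimpleGraph V) (γ : ℤ → V) : Prop :=
  ∀ i j, T.dist (γ i) (γ j) = (j - i).natAbs

/-- `P` describes the projection of the tree to the line `γ`. -/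
def IsProjection (T : SimpleGraph V) (γ : ℤ → V) (P : V → ℤ) : Prop :=
  ∀ x i, T.dist x (γ i) = T.dist x (γ (P x)) + (i - P x).natAbs

theorem IsLine.adj {γ : ℤ → V} (h : IsLine T γ) (i : ℤ) : T.Adj (γ i) (γ (i + 1)) := by
  rw [← SimpleGraph.dist_eq_one_iff_adj, h]; omega

theorem IsLine.injective {γ : ℤ → V} (h : IsLine T γ) {i j : ℤ} (hij : γ i = γ j) : i = j := by
  have := h i j
  rw [hij, SimpleGraph.dist_self] at this
  omega

theorem IsMetricTree.exists_projection (hT : IsMetricTree T) {γ : ℤ → V} (h : IsLine T γ) :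
    ∃ P, IsProjection T γ P := by
  have : ∀ x, ∃ i, ∀ j, T.dist x (γ j) = T.dist x (γ i) + (j - i).natAbs := by
    intro x
    obtain ⟨i, hi⟩ : ∃ i, ∀ j, T.dist x (γ i) ≤ T.dist x (γ j) :=
      ⟨_, fun j => Function.argmin_le (fun i => T.dist x (γ i)) j⟩
    exact ⟨i, hT.eq_add_natAbs_of_path h.adj
      (fun i hi => by have := h.injective hi; omega) (hi _) (hi _)⟩
  choose P hP using this
  exact ⟨P, hP⟩

namespace IsProjection

variable {γ : ℤ → V} {P : V → ℤ} (hP : IsProjection T γ P)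
include hP

theorem apply_line (h : IsLine T γ) (i : ℤ) : P (γ i) = i := by
  have h1 := hP (γ i) i
  have h2 := h i (P (γ i))
  have h3 := h i i
  omega

/-- The distance profile of `x` along the line has a single minimum, which determines both the
projection and the distance to the line. -/
theorem eq_of_forall {x : V} {i : ℤ} {n : ℕ} (h : ∀ j, T.dist x (γ j) = n + (j - i).natAbs) :
    P x = i ∧ T.dist x (γ (P x)) = n := by
  have h1 := hP x i
  have h2 := h i
  have h3 := h (P x)
  have : P x = i := by omega
  rw [this] at h3 ⊢
  exact ⟨rfl, by omega⟩

/-- The edge of the line that follows the projection of `x` separates `x` from `y`. -/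
theorem dist_eq_of_lt (hT : IsMetricTree T) (h : IsLine T γ) {x y : V} (hlt : P x < P y) :
    T.dist x y = T.dist x (γ (P x)) + (P y - P x).natAbs + T.dist (γ (P y)) y := by
  have h1 := hP x (P x + 1)
  have h2 := hP y (P x + 1)
  have h3 := hP y (P x)
  have := hT.dist_eq_of_adj (h.adj (P x)) (x := x) (y := y) (by omega) (by omega)
  rw [this, SimpleGraph.dist_comm (v := y), SimpleGraph.dist_comm (v := y)]
  omega

theorem dist_eq (hT : IsMetricTree T) (h : IsLine T γ) {x y : V} (hne : P x ≠ P y) :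
    T.dist x y = T.dist x (γ (P x)) + (P y - P x).natAbs + T.dist (γ (P y)) y := by
  rcases lt_or_gt_of_ne hne with hlt | hlt
  · exact hP.dist_eq_of_lt hT h hlt
  · have := hP.dist_eq_of_lt hT h hlt
    rw [SimpleGraph.dist_comm, this, SimpleGraph.dist_comm (u := y),
      SimpleGraph.dist_comm (v := x)]
    omega

end IsProjection

end TreeLike

/-! ### Hyperbolic isometries and their axes -/

section Axes

variable {V : Type*} {T : SimpleGraph V} {H : Type*} [Group H] [MulAction H V]

theorem translationLength_le (g : H) (x : V) : translationLength T g ≤ T.dist x (g • x) :=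
  Nat.sInf_le ⟨x, rfl⟩

theorem exists_mem_axis [Nonempty V] (g : H) : ∃ x, x ∈ axis T g :=
  Nat.sInf_mem (Set.range_nonempty fun x : V => T.dist x (g • x))

/-- The group `H` acts on `T` by isometries. -/
def ActsByIsometries (T : SimpleGraph V) (H : Type*) [Group H] [MulAction H V] : Prop :=
  ∀ (g : H) (x y : V), T.dist (g • x) (g • y) = T.dist x y

theorem ActsByIsometries.adj (hact : ActsByIsometries T H) (g : H) {x y : V} (h : T.Adj x y) :
    T.Adj (g • x) (g • y) := by
  rw [← SimpleGraph.dist_eq_one_iff_adj] at *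
  rw [hact, h]

theorem ActsByIsometries.dist_inv_smul (hact : ActsByIsometries T H) (g : H) (x y : V) :
    T.dist (g⁻¹ • x) y = T.dist x (g • y) := by
  rw [← hact g, smul_inv_smul]

/-- The line `γ` is the axis of `g`, parametrised in the direction of the translation. -/
structure IsAxisLine (T : SimpleGraph V) (g : H) (γ : ℤ → V) : Prop where
  line : IsLine T γ
  smul : ∀ i, g • γ i = γ (i + translationLength T g)
  mem_axis_iff : ∀ x, x ∈ axis T g ↔ ∃ i, γ i = x

/-- The distance profile of `g • x` along the line is that of `x` shifted by `n`. -/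
theorem IsProjection.apply_smul (hact : ActsByIsometries T H) {g : H} {γ : ℤ → V} {P : V → ℤ}
    (hP : IsProjection T γ P) {n : ℕ} (hg : ∀ i, g • γ i = γ (i + n)) (x : V) :
    P (g • x) = P x + n ∧ T.dist (g • x) (γ (P (g • x))) = T.dist x (γ (P x)) := by
  refine hP.eq_of_forall (n := T.dist x (γ (P x))) fun j => ?_
  have h1 := hg (j - n)
  rw [sub_add_cancel] at h1
  rw [← h1, hact, hP]
  omega

/-- The translates by powers of `g` of a geodesic from a least moved vertex `x` to `g • x` are
joined end to end. Backtracking would shorten the displacement below the minimum, or, for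
translation length one, make `g` invert an edge. -/
theorem exists_translated_line (hT : IsMetricTree T) (hact : ActsByIsometries T H) (g : H)
    (hpos : 0 < translationLength T g) (hinv : ∀ x : V, g • g • x ≠ x) :
    ∃ γ : ℤ → V, IsLine T γ ∧ ∀ i, g • γ i = γ (i + translationLength T g) := by
  have := hT.connected.nonempty
  obtain ⟨x, hx⟩ := exists_mem_axis (T := T) g
  obtain ⟨q, hq⟩ := hT.connected.exists_walk_length_eq_dist x (g • x)
  change T.dist x (g • x) = translationLength T g at hx
  have hle := translationLength_le (T := T) g
  set n := translationLength T g with hn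
  rw [hx] at hq
  have hn0 : (n : ℤ) ≠ 0 := by omega
  -- Including `r = n` records that consecutive translates match at their common end, so that edges
  -- can be checked within one translate.
  obtain ⟨γ, hγ⟩ : ∃ γ : ℤ → V, ∀ (k : ℤ) (r : ℕ), r ≤ n →
      γ (r + n * k) = g ^ k • q.getVert r := by
    refine ⟨fun i => g ^ (i / n) • q.getVert (i % n).toNat, fun k r hr => ?_⟩
    simp only [Int.add_mul_ediv_left _ _ hn0, Int.add_mul_emod_self_left]
    rcases hr.lt_or_eq with h | rfl
    · rw [Int.ediv_eq_zero_of_lt (by omega) (by omega), Int.emod_eq_of_lt (by omega) (by omega)]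
      simp
    · rw [Int.ediv_self hn0, Int.emod_self, ← hq, SimpleGraph.Walk.getVert_length, zpow_add]
      simp [← mul_smul]
      rw [← zpow_one_add, ← zpow_add_one, add_comm]
  have hdecomp : ∀ i : ℤ, ∃ (k : ℤ) (r : ℕ), r < n ∧ i = r + n * k := by
    intro i
    have h1 := Int.emod_nonneg i hn0
    have h2 := Int.emod_lt_of_pos i (b := n) (by omega)
    refine ⟨i / n, (i % n).toNat, by omega, ?_⟩
    rw [Int.toNat_of_nonneg h1]
    exact (Int.emod_add_mul_ediv i n).symm
  have hadj : ∀ i, T.Adj (γ i) (γ (i + 1)) := by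
    intro i
    obtain ⟨k, r, hr, rfl⟩ := hdecomp i
    rw [hγ k r hr.le, show (r : ℤ) + n * k + 1 = ((r + 1 : ℕ) : ℤ) + n * k by push_cast; ring,
      hγ k (r + 1) hr]
    exact hact.adj _ (q.adj_getVert_succ (by omega))
  have htr : ∀ i, g • γ i = γ (i + n) := by
    intro i
    obtain ⟨k, r, hr, rfl⟩ := hdecomp i
    rw [hγ k r hr.le, show (r : ℤ) + n * k + n = r + n * (1 + k) by ring, hγ _ r hr.le,
      zpow_one_add, mul_smul]
  have hd : ∀ (i : ℤ) (k : ℕ), T.dist (γ i) (γ (i + k)) ≤ k := by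
    intro i k
    induction k with
    | zero => simp
    | succ k ih =>
      have := hT.connected.dist_le_succ_of_adj (hadj (i + k)) (γ i)
      push_cast
      rw [← add_assoc]
      omega
  refine ⟨γ, hT.dist_of_path hadj fun i hi => ?_, htr⟩
  -- If `γ i = γ (i + 2)`, then `γ i` is within `n - 2` of its image `γ (i + n)`; truncated
  -- subtraction forces the case `n = 1` to be separate.
  by_cases h1 : n = 1
  · refine hinv (γ i) ?_
    rw [htr, htr, h1, hi]
    congr 1
    push_cast
    ring
  · have h2 := hle (γ i)
    have h3 := hd (i + 2) (n - 2)
    rw [htr, hi] at h2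
    rw [show i + 2 + ((n - 2 : ℕ) : ℤ) = i + n by omega] at h3
    omega

/-- A vertex at distance `r` from the translated line is moved by `2r + l(g)`, so the least moved
vertices are those of the line. -/
theorem exists_axisLine (hT : IsMetricTree T) (hact : ActsByIsometries T H) (g : H)
    (hpos : 0 < translationLength T g) (hinv : ∀ x : V, g • g • x ≠ x) :
    ∃ γ : ℤ → V, IsAxisLine T g γ := by
  obtain ⟨γ, hγ, htr⟩ := exists_translated_line hT hact g hpos hinv
  obtain ⟨P, hP⟩ := hT.exists_projection hγ
  refine ⟨γ, hγ, htr, fun x => ⟨fun hx => ⟨P x, ?_⟩, ?_⟩⟩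
  · change T.dist x (g • x) = _ at hx
    obtain ⟨h1, h2⟩ := hP.apply_smul hact htr x
    rw [hP.dist_eq hT hγ (by omega), SimpleGraph.dist_comm (v := g • x), h2] at hx
    exact (hT.connected.dist_eq_zero_iff.1 (by omega : T.dist x (γ (P x)) = 0)).symm
  · rintro ⟨i, rfl⟩
    change T.dist _ _ = _
    rw [htr, hγ]
    omega

theorem mem_backwardSubtree_iff {γ : ℤ → V} {P : V → ℤ} (hP : IsProjection T γ P) (k : ℤ) (x : V) :
    x ∈ backwardSubtree T (γ k, γ (k + 1)) ↔ P x ≤ k := by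
  change T.dist x (γ k) < T.dist x (γ (k + 1)) ↔ _
  rw [hP x k, hP x (k + 1)]
  omega

theorem mem_forwardSubtree_iff {g : H} {γ : ℤ → V} {P : V → ℤ} (hg : IsAxisLine T g γ)
    (hP : IsProjection T γ P) (k : ℤ) (x : V) :
    x ∈ forwardSubtree T g (γ k, γ (k + 1)) ↔ k + translationLength T g < P x := by
  change T.dist x (g • γ (k + 1)) < T.dist x (g • γ k) ↔ _
  rw [hg.smul, hg.smul, hP x (k + 1 + _), hP x (k + _)]
  omega

theorem IsAxisLine.isForwardEdge_iff {g : H} {γ : ℤ → V} (hg : IsAxisLine T g γ)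
    (hpos : 0 < translationLength T g) (e : V × V) :
    IsForwardEdge T g e ↔ ∃ k, e = (γ k, γ (k + 1)) := by
  constructor
  · rintro ⟨h1, h2, h3, h4⟩
    obtain ⟨e₁, e₂⟩ := e
    obtain ⟨i, rfl⟩ := (hg.mem_axis_iff _).1 h1
    obtain ⟨j, rfl⟩ := (hg.mem_axis_iff _).1 h2
    rw [← SimpleGraph.dist_eq_one_iff_adj] at h3
    simp only [hg.smul] at h4
    rw [hg.line] at h3 h4
    have : j = i + 1 := by omega
    subst this
    exact ⟨i, rfl⟩
  · rintro ⟨k, rfl⟩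
    refine ⟨(hg.mem_axis_iff _).2 ⟨_, rfl⟩, (hg.mem_axis_iff _).2 ⟨_, rfl⟩, hg.line.adj k, ?_⟩
    simp only [hg.smul]
    rw [hg.line]
    omega

end Axes

/-! ### Ping-pong in projection coordinates -/

section PingPong

variable {V : Type*} {T : SimpleGraph V} {H : Type*} [Group H] [MulAction H V]

/-- Two hyperbolic isometries with parametrised axes and the projections to these axes. -/
structure AxisPair (T : SimpleGraph V) (X Y : H) (γ η : ℤ → V) (P Q : V → ℤ) : Prop where
  tree : IsMetricTree T
  isometries : ActsByIsometries T H
  posX : 0 < translationLength T X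
  posY : 0 < translationLength T Y
  axisX : IsAxisLine T X γ
  axisY : IsAxisLine T Y η
  projX : IsProjection T γ P
  projY : IsProjection T η Q

theorem exists_axisPair (hT : IsMetricTree T) (hact : ActsByIsometries T H) {X Y : H}
    (hX : 0 < translationLength T X) (hY : 0 < translationLength T Y)
    (hX2 : ∀ x : V, X • X • x ≠ x) (hY2 : ∀ x : V, Y • Y • x ≠ x) :
    ∃ γ η P Q, AxisPair T X Y γ η P Q := by
  obtain ⟨γ, hγ⟩ := exists_axisLine hT hact X hX hX2
  obtain ⟨η, hη⟩ := exists_axisLine hT hact Y hY hY2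
  obtain ⟨P, hP⟩ := hT.exists_projection hγ.line
  obtain ⟨Q, hQ⟩ := hT.exists_projection hη.line
  exact ⟨γ, η, P, Q, hT, hact, hX, hY, hγ, hη, hP, hQ⟩

theorem IsBridge.symm {X Y : H} {p q : V} (h : IsBridge T X Y p q) : IsBridge T Y X q p :=
  ⟨h.2.1, h.1, fun a ha b hb => by
    rw [SimpleGraph.dist_comm, SimpleGraph.dist_comm (u := a)]; exact h.2.2 b hb a ha⟩

namespace AxisPair

variable {X Y : H} {γ η : ℤ → V} {P Q : V → ℤ} (h : AxisPair T X Y γ η P Q)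
include h

theorem symm : AxisPair T Y X η γ Q P :=
  ⟨h.tree, h.isometries, h.posY, h.posX, h.axisY, h.axisX, h.projY, h.projX⟩

theorem proj_line (i : ℤ) : P (γ i) = i := h.projX.apply_line h.axisX.line i

theorem mem_axis (i : ℤ) : γ i ∈ axis T X := (h.axisX.mem_axis_iff _).2 ⟨i, rfl⟩

theorem eq_of_mem_axis {x : V} (hx : x ∈ axis T X) : γ (P x) = x := by
  obtain ⟨i, rfl⟩ := (h.axisX.mem_axis_iff _).1 hx
  rw [h.proj_line]

theorem exists_bridge : ∃ p q, IsBridge T X Y p q := by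
  let d : ℤ × ℤ → ℕ := fun i => T.dist (γ i.1) (η i.2)
  refine ⟨γ (Function.argmin d).1, η (Function.argmin d).2, h.mem_axis _, h.symm.mem_axis _, ?_⟩
  intro a ha b hb
  rw [← h.eq_of_mem_axis ha, ← h.symm.eq_of_mem_axis hb]
  exact Function.argmin_le d (P a, Q b)

theorem bridge_proj {p q : V} (hb : IsBridge T X Y p q) : P q = P p := by
  have h1 := hb.2.2 _ (h.mem_axis (P q)) q hb.2.1
  have h2 := h.projX q (P p)
  rw [h.eq_of_mem_axis hb.1, SimpleGraph.dist_comm, SimpleGraph.dist_comm (u := q)] at h2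
  omega

/-- Every vertex is projected to the end of a path joining the axes on one of the axes. -/
theorem exists_bridge_proj (x : V) :
    ∃ p q, IsBridge T X Y p q ∧ (P x = P p ∨ Q x = Q q) := by
  let B := {b : V × V // IsBridge T X Y b.1 b.2}
  have : Nonempty B := by
    obtain ⟨p, q, hb⟩ := h.exists_bridge
    exact ⟨⟨(p, q), hb⟩⟩
  let d : B → ℕ := fun b => T.dist x b.1.1
  -- Among all bridges, one with `p` closest to `x` is taken.
  obtain ⟨⟨⟨p, q⟩, hb⟩, hmin⟩ : ∃ b, ∀ b', d b ≤ d b' := 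
    ⟨_, fun b => Function.argmin_le d b⟩
  dsimp only at hb
  refine ⟨p, q, hb, ?_⟩
  by_contra! hne
  obtain ⟨hP, hQ⟩ := hne
  have hPq := h.bridge_proj hb
  have hQp := h.symm.bridge_proj hb.symm
  have hγp := h.eq_of_mem_axis hb.1
  have hηq := h.symm.eq_of_mem_axis hb.2.1
  have e1 := h.projX.dist_eq h.tree h.axisX.line (x := x) (y := p) hP
  have e2 := h.projX.dist_eq h.tree h.axisX.line (x := x) (y := q)
    (by rw [hPq]; exact hP)
  have e3 := h.projY.dist_eq h.tree h.axisY.line (x := x) (y := q) hQ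
  have e4 := h.projY.dist_eq h.tree h.axisY.line (x := x) (y := p)
    (by rw [hQp]; exact hQ)
  rw [hPq, hγp] at e2
  rw [hQp, hηq] at e4
  rw [hγp, SimpleGraph.dist_self] at e1
  rw [hηq, SimpleGraph.dist_self] at e3
  have e5 := SimpleGraph.dist_comm (G := T) (u := p) (v := q)
  -- The equations say that `p` lies between `x` and `q` and that `q` lies between `x` and `p`. So
  -- the axes meet at `p`, and each axis has a neighbour of `p` closer to `x`; the two coincide and
  -- give a closer bridge.
  obtain rfl : p = q := h.tree.connected.dist_eq_zero_iff.1 (by omega)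
  obtain ⟨i, hi, hi'⟩ : ∃ i, T.Adj p (γ i) ∧ T.dist x (γ i) < T.dist x p := by
    rcases lt_or_gt_of_ne hP with hlt | hlt
    · refine ⟨P p - 1, ?_, ?_⟩
      · have := h.axisX.line.adj (P p - 1)
        rw [sub_add_cancel, hγp] at this
        exact this.symm
      · rw [h.projX x (P p - 1)]; omega
    · refine ⟨P p + 1, ?_, ?_⟩
      · have := h.axisX.line.adj (P p)
        rwa [hγp] at this
      · rw [h.projX x (P p + 1)]; omega
  obtain ⟨j, hj, hj'⟩ : ∃ j, T.Adj p (η j) ∧ T.dist x (η j) < T.dist x p := by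
    rcases lt_or_gt_of_ne hQ with hlt | hlt
    · refine ⟨Q p - 1, ?_, ?_⟩
      · have := h.axisY.line.adj (Q p - 1)
        rw [sub_add_cancel, hηq] at this
        exact this.symm
      · rw [h.projY x (Q p - 1)]; omega
    · refine ⟨Q p + 1, ?_, ?_⟩
      · have := h.axisY.line.adj (Q p)
        rwa [hηq] at this
      · rw [h.projY x (Q p + 1)]; omega
  have hij := h.tree.eq_of_closer hi hj hi' hj'
  have := hmin ⟨(γ i, γ i), h.mem_axis i, hij ▸ h.symm.mem_axis j, by simp⟩
  change T.dist x p ≤ T.dist x (γ i) at this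
  omega

/-- If the axes meet, the ends of bridges are common vertices and the ping-pong hypothesis applies.
If they are disjoint, two bridges with different ends would bound a cycle: the path between the ends
on either axis would be longer than the one on the other. -/
theorem dist_bridge_lt (hpp : IsPingPongPair T X Y) {p₁ q₁ p₂ q₂ : V}
    (h₁ : IsBridge T X Y p₁ q₁) (h₂ : IsBridge T X Y p₂ q₂) :
    T.dist p₁ p₂ < translationLength T X := by
  have h12 : T.dist p₁ q₁ = T.dist p₂ q₂ :=
    le_antisymm (h₁.2.2 _ h₂.1 _ h₂.2.1) (h₂.2.2 _ h₁.1 _ h₁.2.1)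
  by_cases h0 : T.dist p₁ q₁ = 0
  · obtain rfl := h.tree.connected.dist_eq_zero_iff.1 h0
    obtain rfl := h.tree.connected.dist_eq_zero_iff.1 (h12 ▸ h0)
    exact (hpp.2.2 _ ⟨h₁.1, h₁.2.1⟩ _ ⟨h₂.1, h₂.2.1⟩).trans_le (min_le_left _ _)
  · have a1 := h.bridge_proj h₁
    have a2 := h.bridge_proj h₂
    have b1 := h.symm.bridge_proj h₁.symm
    have b2 := h.symm.bridge_proj h₂.symm
    have c1 := h.eq_of_mem_axis h₁.1
    have c2 := h.eq_of_mem_axis h₂.1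
    have d1 := h.symm.eq_of_mem_axis h₁.2.1
    have d2 := h.symm.eq_of_mem_axis h₂.2.1
    have hpos := h.posX
    by_cases hP : P p₁ = P p₂
    · rw [← c1, ← c2, hP, SimpleGraph.dist_self]
      exact hpos
    · exfalso
      have e1 := h.projX.dist_eq h.tree h.axisX.line (x := q₁) (y := q₂) (by omega)
      have e2 : Q q₁ ≠ Q q₂ := by
        intro hQ
        obtain rfl : q₁ = q₂ := by rw [← d1, ← d2, hQ]
        omega
      have e3 := h.projY.dist_eq h.tree h.axisY.line (x := p₁) (y := p₂) (by omega)
      have e4 := h.projY.dist_eq h.tree h.axisY.line (x := q₁) (y := q₂) (by omega)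
      have e5 := h.projX.dist_eq h.tree h.axisX.line (x := p₁) (y := p₂) (by omega)
      rw [a1, a2, c1, c2] at e1
      rw [b1, b2, d1, d2] at e3
      rw [c1, c2] at e5
      rw [d1, d2] at e4
      simp only [SimpleGraph.dist_self] at e4 e5
      have := SimpleGraph.dist_comm (G := T) (u := p₁) (v := q₁)
      omega

theorem exists_lower_cut (hpp : IsPingPongPair T X Y) :
    ∃ k : ℤ, ∀ p q, IsBridge T X Y p q → k < P p ∧ P p ≤ k + translationLength T X := by
  obtain ⟨p₀, q₀, h₀⟩ := h.exists_bridge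
  have hlt : ∀ p q p' q', IsBridge T X Y p q → IsBridge T X Y p' q' →
      (P p' - P p).natAbs < translationLength T X := by
    intro p q p' q' hb hb'
    have := h.dist_bridge_lt hpp hb hb'
    rwa [← h.eq_of_mem_axis hb.1, ← h.eq_of_mem_axis hb'.1, h.axisX.line] at this
  obtain ⟨i, ⟨p, q, hb, rfl⟩, hi⟩ := Int.exists_least_of_bdd
    (P := fun i => ∃ p q, IsBridge T X Y p q ∧ P p = i)
    ⟨P p₀ - translationLength T X, by
      rintro _ ⟨p, q, hb, rfl⟩
      have := hlt _ _ _ _ h₀ hb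
      omega⟩ ⟨_, p₀, q₀, h₀, rfl⟩
  -- The cut is the edge just before the first bridge end; all bridge ends then fit into the period
  -- that follows.
  refine ⟨P p - 1, fun p' q' hb' => ?_⟩
  have h1 := hi _ ⟨p', q', hb', rfl⟩
  have h2 := hlt _ _ _ _ hb hb'
  omega

theorem isCut_iff (k l : ℤ) : IsCut T X Y (γ k, γ (k + 1)) (η l, η (l + 1)) ↔
    ∀ p q, IsBridge T X Y p q → (k < P p ∧ P p ≤ k + translationLength T X) ∧
      (l < Q q ∧ Q q ≤ l + translationLength T Y) := by
  unfold IsCut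
  simp only [mem_backwardSubtree_iff h.projX, mem_backwardSubtree_iff h.projY,
    mem_forwardSubtree_iff h.axisX h.projX, mem_forwardSubtree_iff h.axisY h.projY]
  have h1 := (h.axisX.isForwardEdge_iff h.posX _).2 ⟨k, rfl⟩
  have h2 := (h.axisY.isForwardEdge_iff h.posY _).2 ⟨l, rfl⟩
  simp only [h1, h2, true_and, not_le, not_lt, and_assoc]

theorem exists_isCut (hpp : IsPingPongPair T X Y) : ∃ e f, IsCut T X Y e f := by
  obtain ⟨k, hk⟩ := h.exists_lower_cut hpp
  obtain ⟨l, hl⟩ := h.symm.exists_lower_cut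
    ⟨hpp.2.1, hpp.1, fun c hc d hd => by rw [min_comm]; exact hpp.2.2 c hc.symm d hd.symm⟩
  exact ⟨_, _, (h.isCut_iff k l).2 fun p q hb => ⟨hk p q hb, hl q p hb.symm⟩⟩

theorem exists_of_isCut {e f : V × V} (hc : IsCut T X Y e f) :
    ∃ k l : ℤ, e = (γ k, γ (k + 1)) ∧ f = (η l, η (l + 1)) ∧
      ∀ p q, IsBridge T X Y p q → (k < P p ∧ P p ≤ k + translationLength T X) ∧
      (l < Q q ∧ Q q ≤ l + translationLength T Y) := by
  obtain ⟨k, rfl⟩ := (h.axisX.isForwardEdge_iff h.posX _).1 hc.1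
  obtain ⟨l, rfl⟩ := (h.axisY.isForwardEdge_iff h.posY _).1 hc.2.1
  exact ⟨k, l, rfl, rfl, (h.isCut_iff k l).1 hc⟩

theorem mem_pingPongDomain_iff (k l : ℤ) (x : V) :
    x ∈ pingPongDomain T X Y (γ k, γ (k + 1)) (η l, η (l + 1)) ↔
      (k < P x ∧ P x ≤ k + translationLength T X) ∧ (l < Q x ∧ Q x ≤ l + translationLength T Y) := by
  simp only [pingPongDomain, Set.mem_compl_iff, Set.mem_union,
    mem_backwardSubtree_iff h.projX, mem_backwardSubtree_iff h.projY,
    mem_forwardSubtree_iff h.axisX h.projX, mem_forwardSubtree_iff h.axisY h.projY]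
  omega

end AxisPair

/-- The vertices of the domain. -/
def cutDomain (T : SimpleGraph V) (X Y : H) (P Q : V → ℤ) (k l : ℤ) : Set V :=
  {x | (k < P x ∧ P x ≤ k + translationLength T X) ∧ (l < Q x ∧ Q x ≤ l + translationLength T Y)}

theorem cutDomain_symm {X Y : H} {P Q : V → ℤ} {k l : ℤ} :
    cutDomain T Y X Q P l k = cutDomain T X Y P Q k l := by
  ext x
  exact and_comm

/-- Two hyperbolic isometries with parametrised axes, cut at the edges `[γ k, γ (k + 1)]` and
`[η l, η (l + 1)]`. -/
structure CutPair (T : SimpleGraph V) (X Y : H) (γ η : ℤ → V) (P Q : V → ℤ) (k l : ℤ) : Prop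
    extends AxisPair T X Y γ η P Q where
  bridge : ∀ p q, IsBridge T X Y p q → (k < P p ∧ P p ≤ k + translationLength T X) ∧
      (l < Q q ∧ Q q ≤ l + translationLength T Y)

namespace CutPair

variable {X Y : H} {γ η : ℤ → V} {P Q : V → ℤ} {k l : ℤ} (h : CutPair T X Y γ η P Q k l)
include h

theorem symm : CutPair T Y X η γ Q P l k :=
  { h.toAxisPair.symm with bridge := fun p q hb => (h.bridge q p hb.symm).symm }

/-- This is the disjointness of `U₊ ∪ U₋` from `V₊ ∪ V₋`: on one of the axes `x` projects to a
bridge end, which lies between the cuts. -/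
theorem between_or (x : V) : (k < P x ∧ P x ≤ k + translationLength T X) ∨
    (l < Q x ∧ Q x ≤ l + translationLength T Y) := by
  obtain ⟨p, q, hb, he⟩ := h.exists_bridge_proj x
  have := h.bridge p q hb
  rcases he with he | he
  · left; omega
  · right; omega

theorem bridge_mem_domain {p q : V} (hb : IsBridge T X Y p q) : p ∈ cutDomain T X Y P Q k l := by
  have h1 := h.bridge p q hb
  have h2 := h.symm.bridge_proj hb.symm
  exact ⟨h1.1, by omega⟩

/-- The two extreme vertices of this segment are the points of `D` against which the progress of the
loop is measured. -/
theorem line_mem_domain {i : ℤ} (hi : k < i ∧ i ≤ k + translationLength T X) :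
    γ i ∈ cutDomain T X Y P Q k l := by
  refine ⟨by rwa [h.proj_line], ?_⟩
  obtain ⟨p, q, hb, he⟩ := h.exists_bridge_proj (γ i)
  rcases he with he | he
  · rw [h.proj_line] at he
    rw [he, h.eq_of_mem_axis hb.1]
    exact (h.bridge_mem_domain hb).2
  · have := h.bridge p q hb
    omega

theorem proj_smul (x : V) : P (X • x) = P x + translationLength T X :=
  (h.projX.apply_smul h.isometries h.axisX.smul x).1

theorem proj_inv_smul (x : V) : P (X⁻¹ • x) = P x - translationLength T X := by
  have := h.proj_smul (X⁻¹ • x)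
  rw [smul_inv_smul] at this
  omega

end CutPair

/-- The distance of a vertex from a set of vertices. -/
noncomputable def setDist (T : SimpleGraph V) (D : Set V) (z : V) : ℕ :=
  sInf (T.dist z '' D)

theorem setDist_le {D : Set V} {y : V} (hy : y ∈ D) (z : V) : setDist T D z ≤ T.dist z y :=
  Nat.sInf_le ⟨y, hy, rfl⟩

theorem exists_setDist_eq {D : Set V} (hD : D.Nonempty) (z : V) :
    ∃ y ∈ D, T.dist z y = setDist T D z :=
  Nat.sInf_mem (hD.image _)

namespace CutPair

variable {X Y : H} {γ η : ℤ → V} {P Q : V → ℤ} {k l : ℤ} (h : CutPair T X Y γ η P Q k l)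
include h

theorem domain_nonempty : (cutDomain T X Y P Q k l).Nonempty := by
  obtain ⟨p, q, hb⟩ := h.exists_bridge
  exact ⟨p, h.bridge_mem_domain hb⟩

/-- A geodesic from `z ∈ U₊` to `D` must follow the axis back across the cut edge, up to `γ (k +
l(X))` at least. But `γ (k + 1) ∈ D` is moved by `X` to the vertex just before that crossing, so
applying `X⁻¹` saves at least one edge. -/
theorem setDist_forward {z : V} (hz : k + translationLength T X < P z) :
    setDist T (cutDomain T X Y P Q k l) (X⁻¹ • z) < setDist T (cutDomain T X Y P Q k l) z := by
  obtain ⟨y, hy, hd⟩ := exists_setDist_eq (T := T) h.domain_nonempty z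
  rw [← hd]
  have hpos := h.posX
  have h1 := setDist_le (T := T) (h.line_mem_domain (i := k + 1) (by omega)) (X⁻¹ • z)
  have hy1 := hy.1
  rw [h.isometries.dist_inv_smul, h.axisX.smul, h.projX] at h1
  rw [h.projX.dist_eq h.tree h.axisX.line (x := z) (y := y) (by omega)]
  omega

theorem setDist_backward {z : V} (hz : P z ≤ k) :
    setDist T (cutDomain T X Y P Q k l) (X • z) < setDist T (cutDomain T X Y P Q k l) z := by
  obtain ⟨y, hy, hd⟩ := exists_setDist_eq (T := T) h.domain_nonempty z
  rw [← hd]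
  have hpos := h.posX
  -- Here the vertex of `D` to compare with is `γ (k + l(X)) = X • γ k`, and `γ k` is the last
  -- vertex on the side of `z`.
  have h1 := setDist_le (T := T)
    (h.line_mem_domain (i := k + translationLength T X) (by omega)) (X • z)
  have hy1 := hy.1
  rw [← h.axisX.smul, h.isometries, h.projX] at h1
  rw [h.projX.dist_eq h.tree h.axisX.line (x := z) (y := y) (by omega)]
  omega

/-- The while loop itself, run on `x`, proves that the translates of `D` cover. -/
theorem exists_smul_mem_domain (x : V) :
    ∃ g ∈ Subgroup.closure {X, Y}, g • x ∈ cutDomain T X Y P Q k l := by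
  have hX : X ∈ Subgroup.closure {X, Y} := Subgroup.subset_closure (by simp)
  have hY : Y ∈ Subgroup.closure {X, Y} := Subgroup.subset_closure (by simp)
  induction hn : setDist T (cutDomain T X Y P Q k l) x using Nat.strong_induction_on
    generalizing x with
  | _ n ih =>
    subst hn
    have step : ∀ g ∈ Subgroup.closure {X, Y},
        setDist T (cutDomain T X Y P Q k l) (g • x) < setDist T (cutDomain T X Y P Q k l) x →
        ∃ g ∈ Subgroup.closure {X, Y}, g • x ∈ cutDomain T X Y P Q k l := by
      intro g hg hlt
      obtain ⟨g', hg', hm⟩ := ih _ hlt (g • x) rfl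
      exact ⟨g' * g, mul_mem hg' hg, by rwa [mul_smul]⟩
    by_cases h1 : k < P x
    · by_cases h2 : P x ≤ k + translationLength T X
      · by_cases h3 : l < Q x
        · by_cases h4 : Q x ≤ l + translationLength T Y
          · exact ⟨1, one_mem _, by rw [one_smul]; exact ⟨⟨h1, h2⟩, h3, h4⟩⟩
          · exact step _ (inv_mem hY) (by
              rw [← cutDomain_symm (T := T) (X := X)]; exact h.symm.setDist_forward (not_le.1 h4))
        · exact step _ hY (by
            rw [← cutDomain_symm (T := T) (X := X)]; exact h.symm.setDist_backward (not_lt.1 h3))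
      · exact step _ (inv_mem hX) (h.setDist_forward (not_le.1 h2))
    · exact step _ hX (h.setDist_backward (not_lt.1 h1))

end CutPair

/-- The sets `U₊`, `U₋`, `V₊`, `V₋`, indexed by the letters of words. -/
def pingPongRegion (T : SimpleGraph V) (X Y : H) (P Q : V → ℤ) (k l : ℤ) :
    Fin 2 × Bool → Set V
  | (0, true) => {x | k + translationLength T X < P x}
  | (0, false) => {x | P x ≤ k}
  | (1, true) => {x | l + translationLength T Y < Q x}
  | (1, false) => {x | Q x ≤ l}

theorem notMem_region_of_mem_cutDomain {X Y : H} {P Q : V → ℤ} {k l : ℤ} {x : V}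
    (hx : x ∈ cutDomain T X Y P Q k l) (a : Fin 2 × Bool) : x ∉ pingPongRegion T X Y P Q k l a := by
  obtain ⟨⟨h1, h2⟩, h3, h4⟩ := hx
  obtain ⟨i, a⟩ := a
  fin_cases i <;> cases a <;> simp [pingPongRegion] <;> omega

namespace CutPair

variable {X Y : H} {γ η : ℤ → V} {P Q : V → ℤ} {k l : ℤ} (h : CutPair T X Y γ η P Q k l)
include h

/-- A letter shifts the coordinate on its axis by one period, which is the distance between the
cuts. So it sends everything outside the region of its inverse into its own region. -/
theorem smul_mem_region (i : Fin 2) (b : Bool) {x : V}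
    (hx : x ∉ pingPongRegion T X Y P Q k l (i, !b)) :
    (cond b (![X, Y] i) (![X, Y] i)⁻¹) • x ∈ pingPongRegion T X Y P Q k l (i, b) := by
  have h1 := h.proj_smul x
  have h2 := h.proj_inv_smul x
  have h3 := h.symm.proj_smul x
  have h4 := h.symm.proj_inv_smul x
  fin_cases i <;> cases b <;> simp [pingPongRegion] at hx ⊢ <;> omega

theorem eq_of_mem_region {a b : Fin 2 × Bool} {x : V}
    (ha : x ∈ pingPongRegion T X Y P Q k l a) (hb : x ∈ pingPongRegion T X Y P Q k l b) :
    a = b := by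
  have := h.between_or x
  obtain ⟨i, a⟩ := a
  obtain ⟨j, b⟩ := b
  fin_cases i <;> fin_cases j <;> cases a <;> cases b <;> simp [pingPongRegion] at ha hb ⊢ <;> omega

/-- A nonempty reduced word maps the domain to the region of its first letter. -/
theorem prod_smul_mem_region {x : V} (hx : x ∈ cutDomain T X Y P Q k l) (a : Fin 2 × Bool)
    (L : List (Fin 2 × Bool)) (hL : FreeGroup.IsReduced (a :: L)) :
    ((a :: L).map fun y => cond y.2 (![X, Y] y.1) (![X, Y] y.1)⁻¹).prod • x ∈
      pingPongRegion T X Y P Q k l a := by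
  induction L generalizing a with
  | nil =>
    simpa using h.smul_mem_region a.1 a.2 (notMem_region_of_mem_cutDomain hx _)
  | cons b L ih =>
    rw [FreeGroup.isReduced_cons_cons] at hL
    rw [List.map_cons, List.prod_cons, mul_smul]
    -- The rest of the word lands in the region of `b`. Were this also the region of the inverse of
    -- `a`, disjointness would make `b` the inverse of `a`, against reducedness.
    refine h.smul_mem_region a.1 a.2 fun hmem => ?_
    have := h.eq_of_mem_region (ih b hL.2) hmem
    subst this
    simpa using hL.1 rfl

theorem eval_smul_notMem_domain {x : V} (hx : x ∈ cutDomain T X Y P Q k l) {w : Word}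
    (hw : w ≠ 1) : w.eval X Y • x ∉ cutDomain T X Y P Q k l := by
  intro hmem
  have hred : FreeGroup.IsReduced w.toWord := FreeGroup.isReduced_toWord
  have hev : w.eval X Y =
      (w.toWord.map fun y => cond y.2 (![X, Y] y.1) (![X, Y] y.1)⁻¹).prod := by
    conv_lhs => rw [← FreeGroup.mk_toWord (x := w)]
    exact FreeGroup.lift_mk
  rw [hev] at hmem
  rcases hl : w.toWord with _ | ⟨a, L⟩
  · exact hw (FreeGroup.toWord_eq_nil_iff.1 hl)
  · rw [hl] at hmem hred
    exact notMem_region_of_mem_cutDomain hmem a (h.prod_smul_mem_region hx a L hred)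

end CutPair

theorem Word.eval_mem_closure (X Y : H) (w : Word) : w.eval X Y ∈ Subgroup.closure {X, Y} := by
  have : (FreeGroup.lift ![X, Y]).range = Subgroup.closure {X, Y} := by
    rw [FreeGroup.range_lift_eq_closure]
    simp [Set.pair_comm]
  rw [← this]
  exact ⟨w, rfl⟩

theorem Word.exists_eval_eq {X Y g : H} (hg : g ∈ Subgroup.closure {X, Y}) :
    ∃ w : Word, w.eval X Y = g := by
  have : (FreeGroup.lift ![X, Y]).range = Subgroup.closure {X, Y} := by
    rw [FreeGroup.range_lift_eq_closure]
    simp [Set.pair_comm]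
  rw [← this] at hg
  exact hg

theorem CutPair.eq_one_of_mem_domain {X Y : H} {γ η : ℤ → V} {P Q : V → ℤ} {k l : ℤ}
    (h : CutPair T X Y γ η P Q k l) {x : V} (hx : x ∈ cutDomain T X Y P Q k l) {g : H}
    (hg : g ∈ Subgroup.closure {X, Y}) (hgx : g • x ∈ cutDomain T X Y P Q k l) : g = 1 := by
  obtain ⟨w, rfl⟩ := Word.exists_eval_eq hg
  by_contra hne
  exact h.eval_smul_notMem_domain hx (by rintro rfl; exact hne (map_one _)) hgx

theorem CutPair.isVertexFundamentalDomain {X Y : H} {γ η : ℤ → V} {P Q : V → ℤ} {k l : ℤ}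
    (h : CutPair T X Y γ η P Q k l) :
    IsVertexFundamentalDomain (Subgroup.closure {X, Y}) (cutDomain T X Y P Q k l) := by
  refine ⟨fun x => ?_, fun g hg g' hg' hne => ?_⟩
  · obtain ⟨g, hg, hx⟩ := h.exists_smul_mem_domain x
    exact ⟨g⁻¹, inv_mem hg, Set.mem_smul_set_iff_inv_smul_mem.2 (by rwa [inv_inv])⟩
  · rw [Set.disjoint_left]
    intro x hx hx'
    rw [Set.mem_smul_set_iff_inv_smul_mem] at hx hx'
    have := h.eq_one_of_mem_domain hx (mul_mem (inv_mem hg') hg)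
      (by rwa [mul_smul, smul_inv_smul])
    exact hne (inv_mul_eq_one.1 this).symm

end PingPong

/-! ### Reduction of the generators -/

section Reduction

variable {V : Type*} {T : SimpleGraph V} {H : Type*} [Group H] [MulAction H V]

/-- If the axes of `X` and `Y` share a path of length `l(X) ≤ l(Y)`, then `XY` or `X⁻¹Y` is
short. -/
theorem AxisPair.exists_short {X Y : H} {γ η : ℤ → V} {P Q : V → ℤ}
    (h : AxisPair T X Y γ η P Q) (hle : translationLength T X ≤ translationLength T Y)
    {c d : V} (hc : c ∈ axis T X ∩ axis T Y) (hd : d ∈ axis T X ∩ axis T Y)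
    (hcd : translationLength T X ≤ T.dist c d) :
    min (translationLength T (X * Y)) (translationLength T (X⁻¹ * Y)) + translationLength T X ≤
      translationLength T Y := by
  wlog hlt : Q c ≤ Q d generalizing c d
  · exact this hd hc (by rwa [SimpleGraph.dist_comm]) (le_of_not_ge hlt)
  have c1 := h.eq_of_mem_axis hc.1
  have c2 := h.symm.eq_of_mem_axis hc.2
  have d1 := h.eq_of_mem_axis hd.1
  have d2 := h.symm.eq_of_mem_axis hd.2
  have e1 := h.axisX.line (P c) (P d)
  have e2 := h.axisY.line (Q c) (Q d)
  rw [c1, d1] at e1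
  rw [c2, d2] at e2
  -- The vertex `u` lies on the axis of `Y`, one period of `X` after `c`. It is still on the shared
  -- path, since its distances to `c` and `d` add up to `d(c, d)`.
  set u := η (Q c + translationLength T X) with hu
  have f1 := h.axisY.line (Q c + translationLength T X) (Q c)
  have f2 := h.axisY.line (Q c + translationLength T X) (Q d)
  have f3 := h.axisY.line (Q c + translationLength T X) (Q c + translationLength T Y)
  rw [← hu, c2] at f1
  rw [← hu, d2] at f2
  rw [← hu, ← h.axisY.smul, c2] at f3
  have g1 := h.projX u (P c)
  have g2 := h.projX u (P d)
  rw [c1] at g1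
  rw [d1] at g2
  have hu0 : T.dist u (γ (P u)) = 0 := by omega
  have hu1 : u = γ (P u) := h.tree.connected.dist_eq_zero_iff.1 hu0
  -- The cases are equal and opposite directions of translation. They give `u = X c` or `c = X u`,
  -- and then `X⁻¹Y` or `XY` moves `c` by `d(u, Y c) = l(Y) - l(X)`.
  obtain hPu | hPu : P u = P c + translationLength T X ∨ P c = P u + translationLength T X := by
    omega
  · have : u = X • c := by rw [hu1, hPu, ← h.axisX.smul, c1]
    have hs := translationLength_le (T := T) (X⁻¹ * Y) c
    rw [mul_smul, SimpleGraph.dist_comm, h.isometries.dist_inv_smul, ← this,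
      SimpleGraph.dist_comm, f3] at hs
    have := min_le_right (translationLength T (X * Y)) (translationLength T (X⁻¹ * Y))
    omega
  · have : c = X • u := by rw [hu1, h.axisX.smul, ← hPu, c1]
    have hs := translationLength_le (T := T) (X * Y) c
    rw [mul_smul] at hs
    nth_rw 1 [this] at hs
    rw [h.isometries, f3] at hs
    have := min_le_left (translationLength T (X * Y)) (translationLength T (X⁻¹ * Y))
    omega

theorem mem_of_closure_pair_left {X Y : H} {G : Subgroup H}
    (hG : Subgroup.closure {X, Y} = G) : X ∈ G := hG ▸ Subgroup.subset_closure (by simp)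

theorem mem_of_closure_pair_right {X Y : H} {G : Subgroup H}
    (hG : Subgroup.closure {X, Y} = G) : Y ∈ G := hG ▸ Subgroup.subset_closure (by simp)

/-- The group `G` acts freely and by isometries on the tree `T`, contains no involution and is not
commutative. -/
structure ActsFreely (T : SimpleGraph V) (G : Subgroup H) : Prop where
  tree : IsMetricTree T
  isometries : ActsByIsometries T H
  eq_one_of_smul_eq : ∀ g ∈ G, ∀ x : V, g • x = x → g = 1
  eq_one_of_mul_self : ∀ g ∈ G, g * g = 1 → g = 1
  not_comm : ¬ ∀ g ∈ G, ∀ h ∈ G, g * h = h * g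

namespace ActsFreely

variable {G : Subgroup H} (h : ActsFreely T G)
include h

theorem translationLength_pos {g : H} (hg : g ∈ G) (hne : g ≠ 1) : 0 < translationLength T g := by
  have := h.tree.connected.nonempty
  obtain ⟨x, hx⟩ := exists_mem_axis (T := T) g
  rw [← (show T.dist x (g • x) = translationLength T g from hx), Nat.pos_iff_ne_zero]
  intro h0
  exact hne (h.eq_one_of_smul_eq g hg x (h.tree.connected.dist_eq_zero_iff.1 h0).symm)

/-- This excludes inversions of edges: otherwise `g * g` fixes a vertex, hence is trivial, and `G`
has no involution. -/
theorem smul_smul_ne {g : H} (hg : g ∈ G) (hne : g ≠ 1) (x : V) : g • g • x ≠ x := by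
  intro hx
  rw [← mul_smul] at hx
  exact hne (h.eq_one_of_mul_self g hg (h.eq_one_of_smul_eq _ (mul_mem hg hg) x hx))

/-- Each of `X = 1`, `Y = 1`, `X * Y = 1`, `X⁻¹ * Y = 1` would make the generators commute. This is
why the algorithm never meets a length zero. -/
theorem mul_ne_mul {X Y : H} (hG : Subgroup.closure {X, Y} = G) : X * Y ≠ Y * X := by
  intro hXY
  apply h.not_comm
  rw [← hG]
  intro a ha b hb
  have hcomm : ∀ s ∈ ({X, Y} : Set H), ∀ t ∈ ({X, Y} : Set H), s * t = t * s := by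
    rintro s (rfl | rfl) t (rfl | rfl) <;> first | rfl | exact hXY | exact hXY.symm
  have := Subgroup.isMulCommutative_closure hcomm
  exact setLike_mul_comm ha hb

variable {X Y : H} (hG : Subgroup.closure {X, Y} = G)
include hG

theorem left_ne_one : X ≠ 1 := by
  rintro rfl
  exact h.mul_ne_mul hG (by simp)

theorem right_ne_one : Y ≠ 1 := by
  rintro rfl
  exact h.mul_ne_mul hG (by simp)

theorem left_pos : 0 < translationLength T X :=
  h.translationLength_pos (mem_of_closure_pair_left hG) (h.left_ne_one hG)

theorem right_pos : 0 < translationLength T Y :=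
  h.translationLength_pos (mem_of_closure_pair_right hG) (h.right_ne_one hG)

theorem mul_pos : 0 < translationLength T (X * Y) := by
  refine h.translationLength_pos
    (mul_mem (mem_of_closure_pair_left hG) (mem_of_closure_pair_right hG)) fun h1 => ?_
  refine h.mul_ne_mul hG ?_
  rw [eq_inv_of_mul_eq_one_left h1]
  simp

theorem inv_mul_pos : 0 < translationLength T (X⁻¹ * Y) := by
  refine h.translationLength_pos
    (mul_mem (inv_mem (mem_of_closure_pair_left hG)) (mem_of_closure_pair_right hG)) fun h1 => ?_
  refine h.mul_ne_mul hG ?_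
  rw [inv_mul_eq_one.1 h1]

theorem exists_axisPair : ∃ γ η P Q, AxisPair T X Y γ η P Q :=
  _root_.exists_axisPair h.tree h.isometries (h.left_pos hG) (h.right_pos hG)
    (h.smul_smul_ne (mem_of_closure_pair_left hG) (h.left_ne_one hG))
    (h.smul_smul_ne (mem_of_closure_pair_right hG) (h.right_ne_one hG))

theorem isPingPongPair (hle : translationLength T X ≤ translationLength T Y)
    (hlt : (translationLength T Y : ℤ) - translationLength T X <
      (min (translationLength T (X * Y)) (translationLength T (X⁻¹ * Y)) : ℕ)) :
    IsPingPongPair T X Y := by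
  refine ⟨h.left_pos hG, h.right_pos hG, fun c hc d hd => ?_⟩
  obtain ⟨γ, η, P, Q, hp⟩ := h.exists_axisPair hG
  by_contra hcd
  rw [min_eq_left hle, not_lt] at hcd
  have := hp.exists_short hle hc hd hcd
  omega

theorem exists_cutPair {e f : V × V} (hc : IsCut T X Y e f) :
    ∃ γ η P Q k l, CutPair T X Y γ η P Q k l ∧
      (∀ x, x ∈ backwardSubtree T e ↔ P x ≤ k) ∧
      (∀ x, x ∈ forwardSubtree T X e ↔ k + translationLength T X < P x) ∧
      (∀ x, x ∈ backwardSubtree T f ↔ Q x ≤ l) ∧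
      (∀ x, x ∈ forwardSubtree T Y f ↔ l + translationLength T Y < Q x) ∧
      pingPongDomain T X Y e f = cutDomain T X Y P Q k l := by
  obtain ⟨γ, η, P, Q, hp⟩ := h.exists_axisPair hG
  obtain ⟨k, l, rfl, rfl, hb⟩ := hp.exists_of_isCut hc
  exact ⟨γ, η, P, Q, k, l, ⟨hp, hb⟩, mem_backwardSubtree_iff hp.projX k,
    mem_forwardSubtree_iff hp.axisX hp.projX k, mem_backwardSubtree_iff hp.projY l,
    mem_forwardSubtree_iff hp.axisY hp.projY l, Set.ext fun x => hp.mem_pingPongDomain_iff k l x⟩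

end ActsFreely

theorem Subgroup.closure_pair_mul (X Y : H) :
    Subgroup.closure {X, X * Y} = Subgroup.closure {X, Y} := by
  have hX : ∀ Z, X ∈ Subgroup.closure {X, Z} := fun Z => Subgroup.subset_closure (by simp)
  have hZ : ∀ Z, Z ∈ Subgroup.closure {X, Z} := fun Z => Subgroup.subset_closure (by simp)
  apply le_antisymm
  · rw [Subgroup.closure_le]
    rintro _ (rfl | rfl)
    · exact hX _
    · exact mul_mem (hX _) (hZ _)
  · rw [Subgroup.closure_le]
    rintro Z (rfl | hZY)
    · exact hX _
    · rw [Set.mem_singleton_iff.1 hZY]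
      have := mul_mem (inv_mem (hX (X * Y))) (hZ (X * Y))
      rwa [inv_mul_cancel_left] at this

theorem Subgroup.closure_pair_inv_mul (X Y : H) :
    Subgroup.closure {X, X⁻¹ * Y} = Subgroup.closure {X, Y} := by
  rw [← Subgroup.closure_pair_mul X (X⁻¹ * Y), mul_inv_cancel_left]

end Reduction

/-! ### Invariant, termination and correctness of the algorithm -/

section Correctness

variable {V : Type*} (T : SimpleGraph V) {H : Type*} [Group H] [MulAction H V]

theorem Word.eval_mul (A B : H) (x y : Word) : (x * y).eval A B = x.eval A B * y.eval A B :=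
  map_mul _ _ _

theorem Word.eval_inv (A B : H) (x : Word) : (x⁻¹).eval A B = (x.eval A B)⁻¹ :=
  map_inv _ _

theorem Word.eval_a (A B : H) : Word.a.eval A B = A := by simp [Word.eval, Word.a]

theorem Word.eval_b (A B : H) : Word.b.eval A B = B := by simp [Word.eval, Word.b]

theorem Word.eval_one (A B : H) : Word.eval A B 1 = 1 := map_one _

theorem Word.eval_eval (A B : H) (x y w : Word) :
    (w.eval x y).eval A B = w.eval (x.eval A B) (y.eval A B) := by
  have : (FreeGroup.lift ![A, B]).comp (FreeGroup.lift ![x, y]) =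
      FreeGroup.lift ![x.eval A B, y.eval A B] := by
    ext i
    fin_cases i <;> simp [Word.eval]
  exact DFunLike.congr_fun this w

/-- The invariant of the algorithm. -/
def StateInvariant (A B C : H) : State V → Prop
  | .start => True
  | .order x y => Subgroup.closure {x.eval A B, y.eval A B} = Subgroup.closure {A, B}
  | .compare x y => Subgroup.closure {x.eval A B, y.eval A B} = Subgroup.closure {A, B} ∧
      translationLength T (x.eval A B) ≤ translationLength T (y.eval A B)
  | .abort => False
  | .generators x y => Subgroup.closure {x.eval A B, y.eval A B} = Subgroup.closure {A, B} ∧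
      IsPingPongPair T (x.eval A B) (y.eval A B)
  | .loop x y e f z' w z =>
      Subgroup.closure {x.eval A B, y.eval A B} = Subgroup.closure {A, B} ∧
      IsCut T (x.eval A B) (y.eval A B) e f ∧
      z' ∈ pingPongDomain T (x.eval A B) (y.eval A B) e f ∧
      w.eval (x.eval A B) (y.eval A B) • z = C • z'
  | .answer r => (C ∈ Subgroup.closure {A, B} → ∃ w : Word, r = some w ∧ w.eval A B = C) ∧
      (C ∉ Subgroup.closure {A, B} → r = none)

/-- A quantity that decreases in each step of the algorithm. -/
noncomputable def stateRank (A B : H) : State V → ℕ ×ₗ ℕ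
  | .start => toLex (4, 0)
  -- The doubling leaves room for the step from `order` to `compare`, which keeps the sum of the
  -- lengths. A replacement lowers this sum because `m ≤ l(Y) - l(X) < l(Y)`.
  | .order x y => toLex (3, 2 * (translationLength T (x.eval A B) +
      translationLength T (y.eval A B)) + 1)
  | .compare x y => toLex (3, 2 * (translationLength T (x.eval A B) +
      translationLength T (y.eval A B)))
  | .abort => toLex (0, 0)
  | .generators _ _ => toLex (2, 0)
  | .loop x y e f _ _ z => toLex (1, setDist T (pingPongDomain T (x.eval A B) (y.eval A B) e f) z)
  | .answer _ => toLex (0, 0)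

variable {T}
variable {A B C : H} (h : ActsFreely T (Subgroup.closure {A, B}))
include h

theorem StateInvariant.step {s s' : State V} (hs : StateInvariant T A B C s)
    (hstep : Step T A B C s s') :
    StateInvariant T A B C s' ∧ stateRank T A B s' < stateRank T A B s := by
  cases hstep with
  | start_abort h0 =>
    have h1 := h.left_pos rfl
    have h2 := h.right_pos rfl
    omega
  | start_order hA hB =>
    refine ⟨?_, ?_⟩
    · simp [StateInvariant, Word.eval_a, Word.eval_b]
    · simp [stateRank, Prod.Lex.toLex_lt_toLex]
  | order_swap x y hlt =>
    refine ⟨⟨?_, hlt.le⟩, ?_⟩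
    · rw [Set.pair_comm]
      exact hs
    · simp [stateRank, Prod.Lex.toLex_lt_toLex]
      omega
  | order_keep x y hle =>
    refine ⟨⟨hs, hle⟩, ?_⟩
    simp [stateRank, Prod.Lex.toLex_lt_toLex]
  | compare_abort x y h0 =>
    have h1 := h.mul_pos hs.1
    have h2 := h.inv_mul_pos hs.1
    rw [Word.eval_mul, Word.eval_mul, Word.eval_inv] at h0
    omega
  | compare_replace x y y' m hm h0 hle hy' hl =>
    have hx := h.left_pos hs.1
    refine ⟨?_, ?_⟩
    · rcases hy' with rfl | rfl
      · rw [StateInvariant, Word.eval_mul, Subgroup.closure_pair_mul]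
        exact hs.1
      · rw [StateInvariant, Word.eval_mul, Word.eval_inv, Subgroup.closure_pair_inv_mul]
        exact hs.1
    · simp [stateRank, Prod.Lex.toLex_lt_toLex]
      omega
  | compare_done x y m hm h0 hlt =>
    refine ⟨⟨hs.1, h.isPingPongPair hs.1 hs.2 ?_⟩, ?_⟩
    · rw [hm, Word.eval_mul, Word.eval_mul, Word.eval_inv] at hlt
      exact hlt
    · simp [stateRank, Prod.Lex.toLex_lt_toLex]
  | choose_domain x y e f z' hcut hz' =>
    refine ⟨⟨hs.1, hcut, hz', ?_⟩, ?_⟩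
    · rw [Word.eval_one, one_smul]
    · simp [stateRank, Prod.Lex.toLex_lt_toLex]
  | loop_forward_left x y e f z' w z hz =>
    obtain ⟨hG, hc, hz', hw⟩ := hs
    refine ⟨⟨hG, hc, hz', ?_⟩, ?_⟩
    · rw [Word.eval_mul, Word.eval_a, mul_smul, smul_inv_smul, hw]
    · obtain ⟨γ, η, P, Q, k, l, hp, h1, h2, h3, h4, h5⟩ := h.exists_cutPair hG hc
      simp only [stateRank, Prod.Lex.toLex_lt_toLex, lt_self_iff_false, true_and, false_or, h5]
      exact hp.setDist_forward ((h2 z).1 hz)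
  | loop_backward_left x y e f z' w z hz =>
    obtain ⟨hG, hc, hz', hw⟩ := hs
    refine ⟨⟨hG, hc, hz', ?_⟩, ?_⟩
    · rw [Word.eval_mul, Word.eval_inv, Word.eval_a, mul_smul, inv_smul_smul, hw]
    · obtain ⟨γ, η, P, Q, k, l, hp, h1, h2, h3, h4, h5⟩ := h.exists_cutPair hG hc
      simp only [stateRank, Prod.Lex.toLex_lt_toLex, lt_self_iff_false, true_and, false_or, h5]
      exact hp.setDist_backward ((h1 z).1 hz)
  | loop_forward_right x y e f z' w z hz =>
    obtain ⟨hG, hc, hz', hw⟩ := hs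
    refine ⟨⟨hG, hc, hz', ?_⟩, ?_⟩
    · rw [Word.eval_mul, Word.eval_b, mul_smul, smul_inv_smul, hw]
    · obtain ⟨γ, η, P, Q, k, l, hp, h1, h2, h3, h4, h5⟩ := h.exists_cutPair hG hc
      simp only [stateRank, Prod.Lex.toLex_lt_toLex, lt_self_iff_false, true_and, false_or, h5]
      rw [← cutDomain_symm]
      exact hp.symm.setDist_forward ((h4 z).1 hz)
  | loop_backward_right x y e f z' w z hz =>
    obtain ⟨hG, hc, hz', hw⟩ := hs
    refine ⟨⟨hG, hc, hz', ?_⟩, ?_⟩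
    · rw [Word.eval_mul, Word.eval_inv, Word.eval_b, mul_smul, inv_smul_smul, hw]
    · obtain ⟨γ, η, P, Q, k, l, hp, h1, h2, h3, h4, h5⟩ := h.exists_cutPair hG hc
      simp only [stateRank, Prod.Lex.toLex_lt_toLex, lt_self_iff_false, true_and, false_or, h5]
      rw [← cutDomain_symm]
      exact hp.symm.setDist_backward ((h3 z).1 hz)
  | answer_true x y e f z' w z hz hw =>
    obtain ⟨hG, -⟩ := hs
    refine ⟨⟨fun _ => ⟨_, rfl, by rw [Word.eval_eval, hw.1]⟩, fun hC => absurd ?_ hC⟩, ?_⟩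
    · rw [← hG, ← hw.1]
      exact Word.eval_mem_closure _ _ _
    · simp [stateRank, Prod.Lex.toLex_lt_toLex]
  | answer_false x y e f z' w z hz hw =>
    obtain ⟨hG, hc, hz', hw'⟩ := hs
    refine ⟨⟨fun hC => absurd ?_ hw, fun _ => rfl⟩, ?_⟩
    · obtain ⟨γ, η, P, Q, k, l, hp, h1, h2, h3, h4, h5⟩ := h.exists_cutPair hG hc
      rw [h5] at hz hz'
      have hmem := Word.eval_mem_closure (x.eval A B) (y.eval A B) w
      -- This element of `G` maps `z' ∈ D` to `z ∈ D`, so it is trivial, and the test that was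
      -- assumed to fail succeeds.
      have h6 : (w.eval (x.eval A B) (y.eval A B))⁻¹ * C = 1 := by
        refine hp.eq_one_of_mem_domain hz' (mul_mem (inv_mem hmem) (hG ▸ hC)) ?_
        rwa [mul_smul, ← hw', inv_smul_smul]
      have h7 := inv_mul_eq_one.1 h6
      refine ⟨h7, ?_⟩
      rw [h7] at hw'
      exact smul_left_cancel _ hw'
    · simp [stateRank, Prod.Lex.toLex_lt_toLex]

theorem Reachable.stateInvariant {s : State V} (hs : Reachable T A B C s) :
    StateInvariant T A B C s := by
  induction hs with
  | refl => exact trivial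
  | tail _ hstep ih => exact (ih.step h hstep).1

theorem StateInvariant.exists_step {s : State V} (hs : StateInvariant T A B C s) :
    (∃ s', Step T A B C s s') ∨ ∃ r, s = .answer r := by
  cases s with
  | start => exact .inl ⟨_, .start_order (h.left_pos rfl).ne' (h.right_pos rfl).ne'⟩
  | order x y =>
    rcases lt_or_ge (translationLength T (y.eval A B)) (translationLength T (x.eval A B)) with
      hl | hl
    · exact .inl ⟨_, .order_swap x y hl⟩
    · exact .inl ⟨_, .order_keep x y hl⟩
  | compare x y =>
    left
    by_cases h0 : min (translationLength T ((x * y).eval A B))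
        (translationLength T ((x⁻¹ * y).eval A B)) = 0
    · exact ⟨_, .compare_abort x y h0⟩
    · rcases lt_or_ge ((translationLength T (y.eval A B) : ℤ) - translationLength T (x.eval A B))
        (min (translationLength T ((x * y).eval A B))
          (translationLength T ((x⁻¹ * y).eval A B)) : ℕ) with hl | hl
      · exact ⟨_, .compare_done x y _ rfl h0 hl⟩
      · rcases min_choice (translationLength T ((x * y).eval A B))
          (translationLength T ((x⁻¹ * y).eval A B)) with hm | hm
        · exact ⟨_, .compare_replace x y _ _ rfl h0 hl (.inl rfl) hm.symm⟩
        · exact ⟨_, .compare_replace x y _ _ rfl h0 hl (.inr rfl) hm.symm⟩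
  | abort => exact hs.elim
  | generators x y =>
    left
    obtain ⟨hG, hpp⟩ := hs
    obtain ⟨γ, η, P, Q, hp⟩ := h.exists_axisPair hG
    obtain ⟨e, f, hc⟩ := hp.exists_isCut hpp
    obtain ⟨γ, η, P, Q, k, l, hp, -, -, -, -, h5⟩ := h.exists_cutPair hG hc
    obtain ⟨z, hz⟩ := hp.domain_nonempty
    exact ⟨_, .choose_domain x y e f z hc (h5 ▸ hz)⟩
  | loop x y e f z' w z =>
    left
    by_cases hz : z ∈ pingPongDomain T (x.eval A B) (y.eval A B) e f
    · by_cases hw : w.eval (x.eval A B) (y.eval A B) = C ∧ z = z'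
      · exact ⟨_, .answer_true x y e f z' w z hz hw⟩
      · exact ⟨_, .answer_false x y e f z' w z hz hw⟩
    · rw [pingPongDomain, Set.notMem_compl_iff] at hz
      rcases hz with (hz | hz) | (hz | hz)
      · exact ⟨_, .loop_forward_left x y e f z' w z hz⟩
      · exact ⟨_, .loop_backward_left x y e f z' w z hz⟩
      · exact ⟨_, .loop_forward_right x y e f z' w z hz⟩
      · exact ⟨_, .loop_backward_right x y e f z' w z hz⟩
  | answer r => exact .inr ⟨r, rfl⟩

theorem ActsFreely.terminatesCorrectly (C : H) : TerminatesCorrectly T A B C where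
  no_infinite_run s hs := by
    by_contra! hrun
    have hinv : ∀ n, StateInvariant T A B C (s n) := by
      intro n
      induction n with
      | zero => rw [hs]; exact trivial
      | succ n ih => exact (ih.step h (hrun n)).1
    exact (RelEmbedding.natGT (fun n => stateRank T A B (s n))
      fun n => ((hinv n).step h (hrun n)).2).not_wellFounded wellFounded_lt
  stops_at_answer s hs := (hs.stateInvariant h).exists_step h
  answer_of_mem hC r hr := (hr.stateInvariant h).1 hC
  answer_of_not_mem hC r hr := (hr.stateInvariant h).2 hC
  generators_spec x y hr := hr.stateInvariant h
  domain_spec x y e f z' w z hr := by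
    obtain ⟨hG, hc, -, -⟩ := hr.stateInvariant h
    obtain ⟨γ, η, P, Q, k, l, hp, -, -, -, -, h5⟩ := h.exists_cutPair hG hc
    rw [h5, ← hG]
    exact hp.isVertexFundamentalDomain

end Correctness

/-! ### Free actions from finite stabilisers -/

section FreeGroups

variable {V : Type*} {T : SimpleGraph V} {H : Type*} [Group H] [MulAction H V] {G : Subgroup H}

theorem IsFreeOfRankTwo.eq_one_of_isOfFinOrder (hG : IsFreeOfRankTwo G) {g : H} (hg : g ∈ G)
    (h : IsOfFinOrder g) : g = 1 := by
  obtain ⟨φ⟩ := hG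
  have h1 : IsOfFinOrder (⟨g, hg⟩ : G) := Submonoid.isOfFinOrder_coe.1 h
  have h2 : IsOfFinOrder (φ.symm ⟨g, hg⟩) := φ.symm.toMonoidHom.isOfFinOrder h1
  have h3 := (isOfFinOrder_iff_eq_one _).1 h2
  have h4 : (⟨g, hg⟩ : G) = 1 := by simpa using h3
  exact congrArg Subtype.val h4

theorem IsFreeOfRankTwo.not_comm (hG : IsFreeOfRankTwo G) :
    ¬ ∀ g ∈ G, ∀ h ∈ G, g * h = h * g := by
  obtain ⟨φ⟩ := hG
  intro hcomm
  have h1 : FreeGroup.of (0 : Fin 2) * FreeGroup.of 1 = FreeGroup.of 1 * FreeGroup.of 0 := by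
    apply φ.injective
    rw [map_mul, map_mul]
    exact Subtype.ext (hcomm _ (φ _).2 _ (φ _).2)
  have h2 := congrArg FreeGroup.toWord h1
  revert h2
  decide

/-- Elements of finite stabilisers have finite order and are trivial in a free group. Discreteness
enters only through `hfin`. -/
theorem IsFreeOfRankTwo.actsFreely (hG : IsFreeOfRankTwo G) (hT : IsMetricTree T)
    (hact : ActsByIsometries T H)
    (hfin : ∀ x : V, {g : H | g ∈ G ∧ g • x = x}.Finite) : ActsFreely T G where
  tree := hT
  isometries := hact
  eq_one_of_smul_eq g hg x hx := by
    refine hG.eq_one_of_isOfFinOrder hg ?_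
    refine finite_powers.1 ((hfin x).subset ?_)
    rintro _ ⟨n, rfl⟩
    refine ⟨pow_mem hg n, ?_⟩
    induction n with
    | zero => simp
    | succ n ih =>
      dsimp only at ih ⊢
      rw [pow_succ, mul_smul, hx, ih]
  eq_one_of_mul_self g hg h2 :=
    hG.eq_one_of_isOfFinOrder hg (isOfFinOrder_iff_pow_eq_one.2 ⟨2, by simp, by rw [pow_two, h2]⟩)
  not_comm := hG.not_comm

end FreeGroups

theorem ActsByIsometries.of_adj {V : Type*} {T : SimpleGraph V} {H : Type*} [Group H]
    [MulAction H V] (hT : T.Connected)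
    (hadj : ∀ (g : H) (x y : V), T.Adj x y → T.Adj (g • x) (g • y)) : ActsByIsometries T H := by
  have hle : ∀ (g : H) (x y : V), T.dist (g • x) (g • y) ≤ T.dist x y := by
    intro g x y
    obtain ⟨p, hp⟩ := hT.exists_walk_length_eq_dist x y
    let φ : T →g T := ⟨fun x => g • x, fun h => hadj g _ _ h⟩
    have := SimpleGraph.dist_le (p.map φ)
    rwa [SimpleGraph.Walk.length_map, hp] at this
  intro g x y
  refine le_antisymm (hle g x y) ?_
  have := hle g⁻¹ (g • x) (g • y)
  rwa [inv_smul_smul, inv_smul_smul] at this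

/-! ### Discrete groups of tree automorphisms -/

section TreeAutomorphisms

variable {V : Type*} {T : SimpleGraph V}

theorem IsMetricTree.finite_ball (hT : IsMetricTree T)
    (hfin : ∀ v : V, (T.neighborSet v).Finite) (x : V) (n : ℕ) : {y | T.dist x y ≤ n}.Finite := by
  induction n with
  | zero =>
    refine (Set.finite_singleton x).subset fun y hy => ?_
    exact (hT.connected.dist_eq_zero_iff.1 (Nat.le_zero.1 hy)).symm
  | succ n ih =>
    refine (ih.union (ih.biUnion fun y _ => hfin y)).subset fun y hy => ?_
    by_cases hxy : x = y
    · left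
      simp [hxy]
    · obtain ⟨u, hu, hd⟩ := hT.exists_closer hxy
      right
      refine Set.mem_biUnion (x := u) ?_ hu.symm
      change T.dist x y ≤ n + 1 at hy
      change T.dist x u ≤ n
      omega

theorem actsByIsometries_automorphisms (hT : T.Connected) : ActsByIsometries T (T ≃g T) :=
  .of_adj hT fun g _ _ h => g.map_adj_iff.2 h

/-- A basic neighbourhood of the identity for pointwise convergence restricts only finitely many
vertices. -/
theorem IsPointwiseDiscrete.exists_finset {G : Subgroup (T ≃g T)} (hG : IsPointwiseDiscrete G) :
    ∃ S : Finset V, ∀ g ∈ G, (∀ s ∈ S, g s = s) → g = 1 := by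
  let : TopologicalSpace V := ⊥
  unfold IsPointwiseDiscrete pointwiseTopology at hG
  rw [induced_compose] at hG
  have h1 := @isOpen_discrete G (_) hG {1}
  obtain ⟨U, hU, hU1⟩ := isOpen_induced_iff.1 h1
  have hid : (fun x => x : V → V) ∈ U := by
    have : (1 : G) ∈ ({1} : Set G) := rfl
    rw [← hU1] at this
    exact this
  obtain ⟨S, u, hu, hSU⟩ := isOpen_pi_iff.1 hU _ hid
  refine ⟨S, fun g hg hgS => ?_⟩
  have : (⟨g, hg⟩ : G) ∈ ({1} : Set G) := by
    rw [← hU1]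
    refine hSU fun s hs => ?_
    change g s ∈ u s
    rw [hgS s hs]
    exact (hu s hs).2
  exact congrArg Subtype.val (Set.mem_singleton_iff.1 this)

/-- An element of `G` is determined by its restriction to a finite set `S`; if it fixes `x`, this
restriction takes values in finite balls about `x`. -/
theorem IsPointwiseDiscrete.finite_stabilizer {G : Subgroup (T ≃g T)}
    (hG : IsPointwiseDiscrete G) (hT : IsMetricTree T)
    (hfin : ∀ v : V, (T.neighborSet v).Finite) (x : V) :
    {g : T ≃g T | g ∈ G ∧ g • x = x}.Finite := by
  obtain ⟨S, hS⟩ := hG.exists_finset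
  have hpi : {f : S → V | ∀ s : S, f s ∈ {y | T.dist x y ≤ T.dist x s}}.Finite :=
    Set.Finite.pi' fun s => hT.finite_ball hfin x _
  refine Set.Finite.of_finite_image (f := fun g (s : S) => g s.1) (hpi.subset ?_) ?_
  · rintro _ ⟨g, ⟨-, hg⟩, rfl⟩ s
    change T.dist x (g • s.1) ≤ T.dist x s
    conv_lhs => rw [← hg]
    rw [actsByIsometries_automorphisms hT.connected]
  · rintro g ⟨hg, -⟩ g' ⟨hg', -⟩ heq
    refine (inv_mul_eq_one.1 (hS _ (mul_mem (inv_mem hg) hg') fun s hs => ?_))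
    have := congrFun heq ⟨s, hs⟩
    change g s = g' s at this
    change g⁻¹ (g' s) = s
    rw [← this]
    exact g.symm_apply_apply s

end TreeAutomorphisms

/-! ### Lattices given by bases -/

section LatticePairs

open ValuativeRel

variable {K : Type*} [Field K]

/-- The determinant of a pair of vectors. -/
def pairDet (e f : Fin 2 → K) : K := e 0 * f 1 - e 1 * f 0

theorem pairDet_combination (e f : Fin 2 → K) (a b c d : K) :
    pairDet (a • e + b • f) (c • e + d • f) = (a * d - b * c) * pairDet e f := by
  simp [pairDet]
  ring

theorem pairDet_smul_smul (e f : Fin 2 → K) (a d : K) :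
    pairDet (a • e) (d • f) = a * d * pairDet e f := by
  simp [pairDet]
  ring

theorem exists_combination {e f : Fin 2 → K} (h : pairDet e f ≠ 0) (u : Fin 2 → K) :
    ∃ a b : K, u = a • e + b • f := by
  refine ⟨pairDet u f / pairDet e f, pairDet e u / pairDet e f, ?_⟩
  ext i
  fin_cases i <;> simp <;> field_simp <;> simp [pairDet] <;> ring

theorem combination_injective {e f : Fin 2 → K} (h : pairDet e f ≠ 0) {a b c d : K}
    (heq : a • e + b • f = c • e + d • f) : a = c ∧ b = d := by
  have h0 := congrFun heq 0
  have h1 := congrFun heq 1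
  simp at h0 h1
  constructor
  · apply mul_right_cancel₀ h
    simp only [pairDet]
    linear_combination f 1 * h0 - f 0 * h1
  · apply mul_right_cancel₀ h
    simp only [pairDet]
    linear_combination e 0 * h1 - e 1 * h0

variable [ValuativeRel K]

/-- The `𝒪`-module generated by two vectors. -/
noncomputable def pairSpan (e f : Fin 2 → K) : Submodule 𝒪[K] (Fin 2 → K) :=
  Submodule.span 𝒪[K] {e, f}

theorem mem_pairSpan {e f u : Fin 2 → K} : u ∈ pairSpan e f ↔
    ∃ a b : K, valuation K a ≤ 1 ∧ valuation K b ≤ 1 ∧ u = a • e + b • f := by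
  rw [pairSpan, Submodule.mem_span_pair]
  constructor
  · rintro ⟨a, b, rfl⟩
    exact ⟨a, b, a.2, b.2, rfl⟩
  · rintro ⟨a, b, ha, hb, rfl⟩
    exact ⟨⟨a, ha⟩, ⟨b, hb⟩, rfl⟩

theorem combination_mem_pairSpan_iff {e f : Fin 2 → K} (h : pairDet e f ≠ 0) {a b : K} :
    a • e + b • f ∈ pairSpan e f ↔ valuation K a ≤ 1 ∧ valuation K b ≤ 1 := by
  rw [mem_pairSpan]
  constructor
  · rintro ⟨c, d, hc, hd, heq⟩
    obtain ⟨rfl, rfl⟩ := combination_injective h heq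
    exact ⟨hc, hd⟩
  · rintro ⟨ha, hb⟩
    exact ⟨a, b, ha, hb, rfl⟩

theorem left_mem_pairSpan (e f : Fin 2 → K) : e ∈ pairSpan e f :=
  Submodule.subset_span (by simp)

theorem right_mem_pairSpan (e f : Fin 2 → K) : f ∈ pairSpan e f :=
  Submodule.subset_span (by simp)

theorem pairSpan_le_iff {e f : Fin 2 → K} {M : Submodule 𝒪[K] (Fin 2 → K)} :
    pairSpan e f ≤ M ↔ e ∈ M ∧ f ∈ M := by
  rw [pairSpan, Submodule.span_le, Set.insert_subset_iff, Set.singleton_subset_iff]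
  rfl

theorem pairSpan_comm (e f : Fin 2 → K) : pairSpan e f = pairSpan f e := by
  rw [pairSpan, Set.pair_comm, pairSpan]

theorem valuation_combination_le {a b c d : K} (ha : valuation K a ≤ 1) (hb : valuation K b ≤ 1)
    (hc : valuation K c ≤ 1) (hd : valuation K d ≤ 1) : valuation K (a * b - c * d) ≤ 1 :=
  𝒪[K].sub_mem (𝒪[K].mul_mem ha hb) (𝒪[K].mul_mem hc hd)

/-- A change of basis with integral coefficients and unit determinant. -/
theorem pairSpan_combination (e f : Fin 2 → K) {a b c d : K} (ha : valuation K a ≤ 1)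
    (hb : valuation K b ≤ 1) (hc : valuation K c ≤ 1) (hd : valuation K d ≤ 1)
    (hdet : valuation K (a * d - b * c) = 1) :
    pairSpan (a • e + b • f) (c • e + d • f) = pairSpan e f := by
  have h0 : a * d - b * c ≠ 0 := by
    intro h
    rw [h, map_zero] at hdet
    exact zero_ne_one hdet
  obtain ⟨δ, hδ⟩ : ∃ δ, δ = a * d - b * c := ⟨_, rfl⟩
  rw [← hδ] at hdet h0
  apply le_antisymm <;> rw [pairSpan_le_iff]
  · exact ⟨mem_pairSpan.2 ⟨a, b, ha, hb, rfl⟩, mem_pairSpan.2 ⟨c, d, hc, hd, rfl⟩⟩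
  · constructor
    · refine mem_pairSpan.2 ⟨d / δ, -b / δ, ?_, ?_, ?_⟩
      · rwa [map_div₀, hdet, div_one]
      · rwa [map_div₀, hdet, div_one, Valuation.map_neg]
      · ext i
        simp only [Pi.add_apply, Pi.smul_apply, smul_eq_mul]
        field_simp
        rw [hδ]
        ring
    · refine mem_pairSpan.2 ⟨-c / δ, a / δ, ?_, ?_, ?_⟩
      · rwa [map_div₀, hdet, div_one, Valuation.map_neg]
      · rwa [map_div₀, hdet, div_one]
      · ext i
        simp only [Pi.add_apply, Pi.smul_apply, smul_eq_mul]
        field_simp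
        rw [hδ]
        ring

/-- The base changes in the two directions have integral determinants with product one, so both are
units. -/
theorem exists_of_pairSpan_eq {e f e' f' : Fin 2 → K} (h : pairSpan e' f' = pairSpan e f)
    (hdet : pairDet e f ≠ 0) :
    ∃ a b c d : K, valuation K a ≤ 1 ∧ valuation K b ≤ 1 ∧ valuation K c ≤ 1 ∧
      valuation K d ≤ 1 ∧ e' = a • e + b • f ∧ f' = c • e + d • f ∧
      valuation K (a * d - b * c) = 1 := by
  have key : ∀ {e f e' f' : Fin 2 → K}, pairSpan e' f' = pairSpan e f →
      ∃ a b c d : K, valuation K a ≤ 1 ∧ valuation K b ≤ 1 ∧ valuation K c ≤ 1 ∧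
        valuation K d ≤ 1 ∧ e' = a • e + b • f ∧ f' = c • e + d • f := by
    intro e f e' f' h
    obtain ⟨a, b, ha, hb, h1⟩ := mem_pairSpan.1 (h ▸ left_mem_pairSpan e' f')
    obtain ⟨c, d, hc, hd, h2⟩ := mem_pairSpan.1 (h ▸ right_mem_pairSpan e' f')
    exact ⟨a, b, c, d, ha, hb, hc, hd, h1, h2⟩
  obtain ⟨a, b, c, d, ha, hb, hc, hd, h1, h2⟩ := key h
  obtain ⟨a', b', c', d', ha', hb', hc', hd', h1', h2'⟩ := key h.symm
  refine ⟨a, b, c, d, ha, hb, hc, hd, h1, h2, ?_⟩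
  have e1 := pairDet_combination e f a b c d
  have e2 := pairDet_combination e' f' a' b' c' d'
  rw [← h1, ← h2] at e1
  rw [← h1', ← h2', e1, ← mul_assoc] at e2
  have e3 : (a' * d' - b' * c') * (a * d - b * c) = 1 := by
    apply mul_right_cancel₀ hdet
    rw [← e2, one_mul]
  have e4 := congrArg (valuation K) e3
  rw [map_mul, map_one] at e4
  refine le_antisymm (valuation_combination_le ha hd hb hc) ?_
  rw [← e4]
  exact mul_le_of_le_one_left' (valuation_combination_le ha' hd' hb' hc')

theorem pairDet_ne_zero_of_pairSpan_eq {e f e' f' : Fin 2 → K}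
    (h : pairSpan e' f' = pairSpan e f) (hdet : pairDet e f ≠ 0) : pairDet e' f' ≠ 0 := by
  obtain ⟨a, b, c, d, -, -, -, -, rfl, rfl, hv⟩ := exists_of_pairSpan_eq h hdet
  rw [pairDet_combination]
  refine mul_ne_zero ?_ hdet
  intro h0
  rw [h0, map_zero] at hv
  exact zero_ne_one hv

theorem valuation_pairDet_eq {e f e' f' : Fin 2 → K}
    (h : pairSpan e' f' = pairSpan e f) (hdet : pairDet e f ≠ 0) :
    valuation K (pairDet e' f') = valuation K (pairDet e f) := by
  obtain ⟨a, b, c, d, -, -, -, -, rfl, rfl, hv⟩ := exists_of_pairSpan_eq h hdet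
  rw [pairDet_combination, map_mul, hv, one_mul]

theorem smul_pairSpan (x : Kˣ) (e f : Fin 2 → K) :
    x • pairSpan e f = pairSpan ((x : K) • e) ((x : K) • f) := by
  ext u
  change (∃ w, w ∈ pairSpan e f ∧ x • w = u) ↔ _
  simp only [mem_pairSpan]
  constructor
  · rintro ⟨_, ⟨a, b, ha, hb, rfl⟩, rfl⟩
    refine ⟨a, b, ha, hb, ?_⟩
    rw [smul_add, Units.smul_def, Units.smul_def, smul_comm, smul_comm (x : K) b]
  · rintro ⟨a, b, ha, hb, rfl⟩
    refine ⟨_, ⟨a, b, ha, hb, rfl⟩, ?_⟩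
    rw [smul_add, Units.smul_def, Units.smul_def, smul_comm, smul_comm (x : K) b]

theorem isLattice_pairSpan {e f : Fin 2 → K} (h : pairDet e f ≠ 0) :
    (pairSpan e f).IsLattice K where
  fg := Submodule.fg_span (Set.toFinite _)
  span_eq_top := by
    rw [eq_top_iff]
    rintro u -
    obtain ⟨a, b, rfl⟩ := exists_combination h u
    exact add_mem (Submodule.smul_mem _ _ (Submodule.subset_span (left_mem_pairSpan e f)))
      (Submodule.smul_mem _ _ (Submodule.subset_span (right_mem_pairSpan e f)))

theorem exists_pairSpan_eq [IsDiscreteValuationRing 𝒪[K]] (L : Lattice2 K) :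
    ∃ e f, pairDet e f ≠ 0 ∧ L.1 = pairSpan e f := by
  have := L.2
  let b := Module.finBasisOfFinrankEq 𝒪[K] L.1 (n := 2)
    (by rw [Submodule.IsLattice.finrank_of_pi K]; simp)
  have hspan : L.1 = pairSpan (b 0 : Fin 2 → K) (b 1) := by
    have h1 := congrArg (Submodule.map L.1.subtype) b.span_eq
    rw [Submodule.map_top, Submodule.range_subtype, Submodule.map_span, ← Set.range_comp] at h1
    refine h1.symm.trans ?_
    rw [pairSpan]
    congr 1
    ext u
    simp [Fin.exists_fin_two, eq_comm]
  refine ⟨b 0, b 1, ?_, hspan⟩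
  intro h0
  have htop := L.2.span_eq_top
  have hmem : ∀ u ∈ Submodule.span K (L.1 : Set (Fin 2 → K)), ∃ x y : K,
      u = x • (b 0 : Fin 2 → K) + y • (b 1 : Fin 2 → K) := by
    intro u hu
    induction hu using Submodule.span_induction with
    | mem u hu =>
      rw [hspan] at hu
      obtain ⟨x, y, -, -, rfl⟩ := mem_pairSpan.1 hu
      exact ⟨x, y, rfl⟩
    | zero => exact ⟨0, 0, by simp⟩
    | add u w _ _ hu hw =>
      obtain ⟨x, y, rfl⟩ := hu
      obtain ⟨x', y', rfl⟩ := hw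
      exact ⟨x + x', y + y', by module⟩
    | smul a u _ hu =>
      obtain ⟨x, y, rfl⟩ := hu
      exact ⟨a * x, a * y, by module⟩
  rw [htop] at hmem
  obtain ⟨x, y, hxy⟩ := hmem (Pi.single 0 1) trivial
  obtain ⟨z, w, hzw⟩ := hmem (Pi.single 1 1) trivial
  have h1 := pairDet_combination (b 0 : Fin 2 → K) (b 1) x y z w
  rw [← hxy, ← hzw, h0, mul_zero] at h1
  simp [pairDet] at h1

/-- The vertex `v` is represented by the lattice with basis `(e, f)`. -/
def Represents (e f : Fin 2 → K) (v : BTVertex K) : Prop :=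
  ∃ L : Lattice2 K, BTVertex.mk K L = v ∧ L.1 = pairSpan e f

theorem exists_represents {e f : Fin 2 → K} (h : pairDet e f ≠ 0) :
    ∃ v, Represents e f v :=
  ⟨_, ⟨pairSpan e f, isLattice_pairSpan h⟩, rfl, rfl⟩

theorem Represents.congr {e f e' f' : Fin 2 → K} {v : BTVertex K} (h : Represents e f v)
    (heq : pairSpan e' f' = pairSpan e f) : Represents e' f' v := by
  obtain ⟨L, hv, hL⟩ := h
  exact ⟨L, hv, hL.trans heq.symm⟩

theorem Represents.smul {e f : Fin 2 → K} {v : BTVertex K} (h : Represents e f v)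
    {x : K} (hx : x ≠ 0) : Represents (x • e) (x • f) v := by
  obtain ⟨L, rfl, hL⟩ := h
  have := L.2
  refine ⟨⟨Units.mk0 x hx • L.1, inferInstance⟩, Quotient.sound ⟨Units.mk0 x hx, rfl⟩, ?_⟩
  change Units.mk0 x hx • L.1 = _
  rw [hL, smul_pairSpan]
  rfl

theorem Represents.eq_iff {e f e' f' : Fin 2 → K} {v v' : BTVertex K} (h : Represents e f v)
    (h' : Represents e' f' v') :
    v = v' ↔ ∃ x : K, x ≠ 0 ∧ pairSpan e f = pairSpan (x • e') (x • f') := by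
  obtain ⟨L, rfl, hL⟩ := h
  obtain ⟨L', rfl, hL'⟩ := h'
  refine (Quotient.eq (r := latticeSetoid K)).trans ?_
  change (∃ x : Kˣ, L.1 = x • L'.1) ↔ _
  rw [hL, hL']
  constructor
  · rintro ⟨x, hx⟩
    exact ⟨x, x.ne_zero, by rw [hx, smul_pairSpan]⟩
  · rintro ⟨x, hx, hx'⟩
    exact ⟨Units.mk0 x hx, by rw [hx', smul_pairSpan]; rfl⟩

theorem Represents.unique {e f : Fin 2 → K} {v v' : BTVertex K} (h : Represents e f v)
    (h' : Represents e f v') : v = v' :=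
  (h.eq_iff h').2 ⟨1, one_ne_zero, by simp⟩

theorem exists_represents_vertex [IsDiscreteValuationRing 𝒪[K]] (v : BTVertex K) :
    ∃ e f, pairDet e f ≠ 0 ∧ Represents e f v := by
  obtain ⟨L, rfl⟩ := Quotient.exists_rep v
  obtain ⟨e, f, h, hL⟩ := exists_pairSpan_eq L
  exact ⟨e, f, h, L, rfl, hL⟩

/-- `ϖ` is a uniformizer of a discretely valued field. -/
structure IsUniformizing (ϖ : K) : Prop where
  ne_zero : ϖ ≠ 0
  lt_one : valuation K ϖ < 1
  le_of_lt_one : ∀ x, valuation K x < 1 → valuation K x ≤ valuation K ϖ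
  exists_pow : ∀ x, x ≠ 0 → valuation K x ≤ 1 → ∃ n : ℕ, valuation K x = valuation K ϖ ^ n

theorem exists_uniformizing [IsDiscreteValuationRing 𝒪[K]] :
    ∃ ϖ : K, IsUniformizing ϖ := by
  obtain ⟨p, hp⟩ := IsDiscreteValuationRing.exists_irreducible 𝒪[K]
  have hunit : ∀ {x : 𝒪[K]}, IsUnit x ↔ valuation K (x : K) = 1 :=
    (Valuation.integer.integers (valuation K)).isUnit_iff_valuation_eq_one
  have hpow : ∀ x : K, x ≠ 0 → valuation K x ≤ 1 →
      ∃ n : ℕ, valuation K x = valuation K (p : K) ^ n := by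
    intro x hx hx1
    obtain ⟨n, u, hu⟩ := IsDiscreteValuationRing.associated_pow_irreducible
      (x := (⟨x, hx1⟩ : 𝒪[K])) (fun h => hx (congrArg Subtype.val h)) hp
    refine ⟨n, ?_⟩
    have h1 := congrArg (fun y : 𝒪[K] => valuation K (y : K)) hu
    simp only [Subring.coe_mul, map_mul, hunit.1 u.isUnit, mul_one, SubmonoidClass.coe_pow,
      map_pow] at h1
    exact h1
  have hlt : valuation K (p : K) < 1 := lt_of_le_of_ne p.2 fun h => hp.not_isUnit (hunit.2 h)
  refine ⟨p, fun h => hp.ne_zero (Subtype.ext h), hlt, ?_, hpow⟩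
  intro x hx
  by_cases h0 : x = 0
  · simp [h0]
  · obtain ⟨n, hn⟩ := hpow x h0 hx.le
    rw [hn] at hx ⊢
    refine pow_le_of_le_one zero_le hlt.le ?_
    rintro rfl
    simp at hx

end LatticePairs

/-! ### Adjacency in terms of bases -/

section BruhatTitsAdjacency

open ValuativeRel

variable {K : Type*} [Field K] [ValuativeRel K]

theorem mem_maximalIdeal_integer_iff (a : 𝒪[K]) : a ∈ 𝓂[K] ↔ valuation K (a : K) < 1 := by
  have hunit : IsUnit a ↔ valuation K (a : K) = 1 :=
    (Valuation.integer.integers (valuation K)).isUnit_iff_valuation_eq_one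
  rw [IsLocalRing.mem_maximalIdeal, mem_nonunits_iff, hunit]
  exact ⟨fun h => lt_of_le_of_ne a.2 h, fun h => h.ne⟩

theorem smul_mem_of_valuation_le (M : Submodule 𝒪[K] (Fin 2 → K)) {a : K}
    (ha : valuation K a ≤ 1) {u : Fin 2 → K} (hu : u ∈ M) : a • u ∈ M :=
  M.smul_mem (⟨a, ha⟩ : 𝒪[K]) hu

theorem IsUniformizing.exists_eq_mul {ϖ : K} (h : IsUniformizing ϖ) {a : K}
    (ha : valuation K a < 1) : ∃ b, valuation K b ≤ 1 ∧ a = ϖ * b := by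
  refine ⟨a / ϖ, ?_, (mul_div_cancel₀ a h.ne_zero).symm⟩
  rw [map_div₀]
  exact div_le_one_of_le₀ (h.le_of_lt_one a ha) zero_le

/-- Let `g` generate the quotient. It has a unit coordinate in any basis of `L`, so it replaces one
basis vector; subtracting a multiple of `g` moves the other one into `L₀`. Then `L = ⟨t, g⟩` and `L₀
= ⟨t, ϖ g⟩`. -/
theorem IsUniformizing.exists_basis_of_quotient [IsDiscreteValuationRing 𝒪[K]] {ϖ : K}
    (h : IsUniformizing ϖ) {L L₀ : Lattice2 K} (hle : L₀.1 ≤ L.1)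
    (hq : Nonempty ((L.1 ⧸ L₀.1.submoduleOf L.1) ≃ₗ[𝒪[K]] (𝒪[K] ⧸ 𝓂[K]))) :
    ∃ e f, pairDet e f ≠ 0 ∧ L.1 = pairSpan e f ∧ L₀.1 = pairSpan e (ϖ • f) := by
  obtain ⟨φ⟩ := hq
  obtain ⟨g, hg, h1, h2⟩ : ∃ g ∈ L.1,
      (∀ s ∈ L.1, ∃ a : K, valuation K a ≤ 1 ∧ s - a • g ∈ L₀.1) ∧
      ∀ a : K, valuation K a ≤ 1 → (a • g ∈ L₀.1 ↔ valuation K a < 1) := by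
    let ψ : L.1 →ₗ[𝒪[K]] (𝒪[K] ⧸ 𝓂[K]) :=
      φ.toLinearMap ∘ₗ (L₀.1.submoduleOf L.1).mkQ
    have hker : ∀ s : L.1, ψ s = 0 ↔ (s : Fin 2 → K) ∈ L₀.1 := by
      intro s
      simp only [ψ, LinearMap.comp_apply, LinearEquiv.coe_coe, LinearEquiv.map_eq_zero_iff,
        Submodule.mkQ_apply, Submodule.Quotient.mk_eq_zero]
      rfl
    have hsurj : Function.Surjective ψ :=
      φ.surjective.comp (Submodule.mkQ_surjective _)
    obtain ⟨g, hg⟩ := hsurj (Submodule.Quotient.mk 1)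
    have hsmul : ∀ a : 𝒪[K], ψ (a • g) = Submodule.Quotient.mk a := by
      intro a
      rw [map_smul, hg, ← Submodule.Quotient.mk_smul, smul_eq_mul, mul_one]
    refine ⟨g, g.2, ?_, ?_⟩
    · intro s hs
      obtain ⟨a, ha⟩ := Submodule.Quotient.mk_surjective _ (ψ ⟨s, hs⟩)
      refine ⟨a, a.2, (hker (⟨s, hs⟩ - a • g)).1 ?_⟩
      rw [map_sub, hsmul, ha, sub_self]
    · intro a ha
      have := hker ((⟨a, ha⟩ : 𝒪[K]) • g)
      rw [hsmul, Submodule.Quotient.mk_eq_zero, mem_maximalIdeal_integer_iff] at this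
      exact this.symm
  have key : ∀ e₁ f₁ : Fin 2 → K, pairDet e₁ f₁ ≠ 0 → L.1 = pairSpan e₁ f₁ →
      ∀ α β : K, valuation K β ≤ 1 → valuation K α = 1 → g = α • e₁ + β • f₁ →
      ∃ e f, pairDet e f ≠ 0 ∧ L.1 = pairSpan e f ∧ L₀.1 = pairSpan e (ϖ • f) := by
    intro e₁ f₁ hdet hL α β hβ hα hgab
    obtain ⟨b, hb, ht⟩ := h1 f₁ (hL ▸ right_mem_pairSpan e₁ f₁)
    set t := f₁ - b • g with htdef
    have hL' : pairSpan t g = pairSpan e₁ f₁ := by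
      have e1 : t = (-(b * α)) • e₁ + (1 - b * β) • f₁ := by
        rw [htdef, hgab]
        module
      rw [e1, hgab]
      refine pairSpan_combination e₁ f₁ ?_ ?_ hα.le hβ ?_
      · rw [Valuation.map_neg, map_mul, hα, mul_one]
        exact hb
      · simpa using valuation_combination_le (a := (1 : K)) (b := 1) (by simp) (by simp) hb hβ
      · rw [show -(b * α) * β - (1 - b * β) * α = -α by ring, Valuation.map_neg, hα]
    refine ⟨t, g, pairDet_ne_zero_of_pairSpan_eq hL' hdet, hL.trans hL'.symm, ?_⟩
    apply le_antisymm
    · intro v hv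
      have hv' := hle hv
      rw [hL, ← hL'] at hv'
      obtain ⟨c, d, hc, hd, rfl⟩ := mem_pairSpan.1 hv'
      have hdg : d • g ∈ L₀.1 := by
        have := sub_mem hv (smul_mem_of_valuation_le L₀.1 hc ht)
        rwa [add_sub_cancel_left] at this
      obtain ⟨d', hd', rfl⟩ := h.exists_eq_mul ((h2 d hd).1 hdg)
      refine mem_pairSpan.2 ⟨c, d', hc, hd', ?_⟩
      rw [smul_smul, mul_comm]
    · rw [pairSpan_le_iff]
      exact ⟨ht, (h2 ϖ h.lt_one.le).2 h.lt_one⟩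
  obtain ⟨e₁, f₁, hdet, hL⟩ := exists_pairSpan_eq L
  obtain ⟨α, β, hα, hβ, hgab⟩ := mem_pairSpan.1 (hL ▸ hg)
  rcases hα.lt_or_eq with hα1 | hα1
  · rcases hβ.lt_or_eq with hβ1 | hβ1
    · exfalso
      -- The quotient is killed by the maximal ideal. With both coordinates of `g` in that ideal,
      -- `g` would lie in `L₀` and generate nothing.
      have hmem : ∀ s ∈ L.1, ∀ a : K, valuation K a < 1 → a • s ∈ L₀.1 := by
        intro s hs a ha
        obtain ⟨b, hb, hsb⟩ := h1 s hs
        have h3 := add_mem (smul_mem_of_valuation_le L₀.1 ha.le hsb)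
          (smul_mem_of_valuation_le L₀.1 hb ((h2 a ha.le).2 ha))
        have h4 : a • (s - b • g) + b • a • g = a • s := by module
        rwa [h4] at h3
      have hg0 : g ∈ L₀.1 := by
        rw [hgab]
        exact add_mem (hmem _ (hL ▸ left_mem_pairSpan e₁ f₁) α hα1)
          (hmem _ (hL ▸ right_mem_pairSpan e₁ f₁) β hβ1)
      have := (h2 1 (by simp)).1 (by rwa [one_smul])
      simp at this
    · exact key f₁ e₁ (by
        intro h0
        apply hdet
        simp only [pairDet] at h0 ⊢
        linear_combination -h0) (hL.trans (pairSpan_comm _ _)) β α hα hβ1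
        (hgab.trans (add_comm _ _))
  · exact key e₁ f₁ hdet hL α β hβ hα1 hgab

theorem IsUniformizing.nonempty_quotient_equiv {ϖ : K}
    (h : IsUniformizing ϖ) {L L₀ : Lattice2 K} {e f : Fin 2 → K} (hdet : pairDet e f ≠ 0)
    (hL : L.1 = pairSpan e f) (hL₀ : L₀.1 = pairSpan e (ϖ • f)) :
    Nonempty ((L.1 ⧸ L₀.1.submoduleOf L.1) ≃ₗ[𝒪[K]] (𝒪[K] ⧸ 𝓂[K])) := by
  have hf : f ∈ L.1 := hL ▸ right_mem_pairSpan e f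
  let ψ : 𝒪[K] →ₗ[𝒪[K]] (L.1 ⧸ L₀.1.submoduleOf L.1) :=
    LinearMap.toSpanSingleton 𝒪[K] _ (Submodule.Quotient.mk ⟨f, hf⟩)
  have hψ : ∀ a : 𝒪[K], ψ a = Submodule.Quotient.mk (a • (⟨f, hf⟩ : L.1)) := fun a => rfl
  have hdet' : pairDet e (ϖ • f) ≠ 0 := by
    have := pairDet_smul_smul e f 1 ϖ
    rw [one_smul] at this
    rw [this]
    simp [h.ne_zero, hdet]
  have hker : LinearMap.ker ψ = 𝓂[K] := by
    ext a
    rw [LinearMap.mem_ker, hψ, Submodule.Quotient.mk_eq_zero, mem_maximalIdeal_integer_iff]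
    change (a : K) • f ∈ L₀.1 ↔ _
    rw [hL₀]
    have e1 : (a : K) • f = (0 : K) • e + ((a : K) / ϖ) • (ϖ • f) := by
      rw [smul_smul, div_mul_cancel₀ _ h.ne_zero, zero_smul, zero_add]
    rw [e1, combination_mem_pairSpan_iff hdet', map_zero, map_div₀,
      div_le_one₀ (zero_lt_iff.2 ((Valuation.ne_zero_iff _).2 h.ne_zero))]
    exact ⟨fun h' => h'.2.trans_lt h.lt_one, fun h' => ⟨zero_le, h.le_of_lt_one _ h'⟩⟩
  have hsurj : Function.Surjective ψ := by
    intro s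
    obtain ⟨⟨s, hs⟩, rfl⟩ := Submodule.Quotient.mk_surjective _ s
    obtain ⟨a, b, ha, hb, rfl⟩ := mem_pairSpan.1 (hL ▸ hs)
    refine ⟨⟨b, hb⟩, ?_⟩
    rw [hψ, Submodule.Quotient.eq]
    change b • f - (a • e + b • f) ∈ L₀.1
    rw [sub_add_cancel_right, ← neg_smul, hL₀]
    exact smul_mem_of_valuation_le _ (by rwa [Valuation.map_neg]) (left_mem_pairSpan _ _)
  exact ⟨((Submodule.quotEquivOfEq _ _ hker).symm.trans
    (ψ.quotKerEquivOfSurjective hsurj)).symm⟩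

theorem IsUniformizing.adj_iff [IsDiscreteValuationRing 𝒪[K]] {ϖ : K}
    (h : IsUniformizing ϖ) (u v : BTVertex K) : (bruhatTitsTree K).Adj u v ↔
      ∃ e f, pairDet e f ≠ 0 ∧ Represents e f u ∧ Represents e (ϖ • f) v := by
  rw [bruhatTitsTree, SimpleGraph.fromRel_adj]
  constructor
  · rintro ⟨-, ⟨L, L₀, hu, hv, hle, hq⟩ | ⟨L, L₀, hu, hv, hle, hq⟩⟩
    · obtain ⟨e, f, hdet, h1, h2⟩ := h.exists_basis_of_quotient hle hq
      exact ⟨e, f, hdet, ⟨L, hu, h1⟩, ⟨L₀, hv, h2⟩⟩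
    · obtain ⟨e, f, hdet, h1, h2⟩ := h.exists_basis_of_quotient hle hq
      -- Adjacency is symmetric: `ϖ L` has index type `𝒪 / 𝓂` in `L₀` and represents the same vertex
      -- as `L`.
      refine ⟨ϖ • f, e, ?_, Represents.congr ⟨L₀, hv, h2⟩ (pairSpan_comm _ _), ?_⟩
      · simp only [pairDet, Pi.smul_apply, smul_eq_mul] at hdet ⊢
        intro h0
        exact hdet (mul_left_cancel₀ h.ne_zero (by linear_combination -h0))
      · exact (Represents.smul ⟨L, hu, h1⟩ h.ne_zero).congr (pairSpan_comm _ _)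
  · rintro ⟨e, f, hdet, hu, hv⟩
    refine ⟨?_, .inl ?_⟩
    -- A homothety by `x` would give `x² ϖ` valuation one by determinants, while `x e ∈ L` makes `x`
    -- integral.
    · rw [Ne, hu.eq_iff hv]
      rintro ⟨x, hx, heq⟩
      have h1 : x • e ∈ pairSpan e f := heq ▸ left_mem_pairSpan _ _
      have h2 : x • e = x • e + (0 : K) • f := by simp
      rw [h2, combination_mem_pairSpan_iff hdet] at h1
      have h3 := valuation_pairDet_eq heq.symm hdet
      rw [smul_comm x ϖ f, smul_smul, pairDet_smul_smul, map_mul] at h3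
      have h4 : valuation K (x * (ϖ * x)) = 1 :=
        mul_right_cancel₀ ((Valuation.ne_zero_iff _).2 hdet) (by rw [h3, one_mul])
      rw [map_mul, map_mul] at h4
      have h5 : valuation K x * (valuation K ϖ * valuation K x) < 1 :=
        (mul_le_of_le_one_left' h1.1).trans_lt ((mul_le_of_le_one_right' h1.1).trans_lt h.lt_one)
      exact h5.ne h4
    · obtain ⟨L, hu, hL⟩ := hu
      obtain ⟨L₀, hv, hL₀⟩ := hv
      refine ⟨L, L₀, hu, hv, ?_, h.nonempty_quotient_equiv hdet hL hL₀⟩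
      rw [hL, hL₀, pairSpan_le_iff]
      exact ⟨left_mem_pairSpan _ _,
        smul_mem_of_valuation_le _ h.lt_one.le (right_mem_pairSpan _ _)⟩

end BruhatTitsAdjacency

/-! ### Levels and the tree property -/

/-- A graph is a tree if the vertices have levels `δ x v` with respect to each vertex `x` such that
each vertex of positive level has one neighbour of lower level, its other neighbours being of
higher level. -/
theorem isMetricTree_of_levels {V : Type*} [Nonempty V] {T : SimpleGraph V} (δ : V → V → ℕ)
    (h0 : ∀ x v, δ x v = 0 ↔ v = x) (h1 : ∀ x v, T.Adj x v → δ x v = 1)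
    (hdown : ∀ x v n, δ x v = n + 1 →
      ∃ u, T.Adj v u ∧ δ x u = n ∧ ∀ w, T.Adj v w → δ x w = n + 2 ∨ w = u) :
    IsMetricTree T := by
  have hwalk : ∀ n x v, δ x v = n → ∃ p : T.Walk v x, p.length = n := by
    intro n x
    induction n with
    | zero =>
      intro v hv
      obtain rfl := (h0 x v).1 hv
      exact ⟨.nil, rfl⟩
    | succ n ih =>
      intro v hv
      obtain ⟨u, hu, hun, -⟩ := hdown x v n hv
      obtain ⟨p, hp⟩ := ih u hun
      exact ⟨.cons hu p, by rw [SimpleGraph.Walk.length_cons, hp]⟩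
  have hadj : ∀ x v w, T.Adj v w → δ x w = δ x v + 1 ∨ δ x v = δ x w + 1 := by
    intro x v w hvw
    rcases hn : δ x v with _ | n
    · obtain rfl := (h0 x v).1 hn
      left
      exact h1 _ _ hvw
    · obtain ⟨u, -, hun, hu⟩ := hdown x v n hn
      rcases hu w hvw with h | rfl
      · omega
      · omega
  have hle : ∀ x v (p : T.Walk v x), δ x v ≤ p.length := by
    intro x v p
    induction p with
    | nil => exact ((h0 _ _).2 rfl).le
    | @cons v w x hvw p ih =>
      have := hadj x _ _ hvw
      rw [SimpleGraph.Walk.length_cons]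
      omega
  have hconn : T.Connected := by
    refine SimpleGraph.connected_iff _ |>.2 ⟨fun v x => ?_, inferInstance⟩
    obtain ⟨p, -⟩ := hwalk _ x v rfl
    exact ⟨p⟩
  -- Levels change by one along each edge and some walk descends all the way to `x`.
  have hdist : ∀ x v, T.dist x v = δ x v := by
    intro x v
    rw [SimpleGraph.dist_comm]
    obtain ⟨p, hp⟩ := hwalk _ x v rfl
    obtain ⟨q, hq⟩ := hconn.exists_walk_length_eq_dist v x
    exact le_antisymm (hp ▸ SimpleGraph.dist_le p) (hq ▸ hle x v q)
  refine ⟨hconn, fun {a b} hab x => ?_, fun {x y u w} hu hw hxu hxw => ?_⟩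
  · have := hadj x a b hab
    rw [hdist, hdist]
    omega
  · rw [hdist, hdist] at hxu hxw
    obtain ⟨n, hn⟩ : ∃ n, δ x y = n + 1 := ⟨δ x y - 1, by omega⟩
    obtain ⟨t, -, -, ht⟩ := hdown x y n hn
    rcases ht u hu with h | rfl
    · omega
    · rcases ht w hw with h | rfl
      · omega
      · rfl

section BruhatTitsLevels

open ValuativeRel

variable {K : Type*} [Field K] [ValuativeRel K]

/-- The vertex `v` is represented by a lattice with basis `(e, ϖ ^ n f)`, where `(e, f)` is a basis
of the lattice with basis `(e₀, f₀)`. -/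
def HasLevel (ϖ : K) (e₀ f₀ : Fin 2 → K) (v : BTVertex K) (n : ℕ) : Prop :=
  ∃ e f, pairSpan e f = pairSpan e₀ f₀ ∧ Represents e (ϖ ^ n • f) v

theorem HasLevel.congr {ϖ : K} {e₀ f₀ e₁ f₁ : Fin 2 → K} {v : BTVertex K} {n : ℕ}
    (h : HasLevel ϖ e₀ f₀ v n) (heq : pairSpan e₀ f₀ = pairSpan e₁ f₁) :
    HasLevel ϖ e₁ f₁ v n := by
  obtain ⟨e, f, h1, h2⟩ := h
  exact ⟨e, f, h1.trans heq, h2⟩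

namespace IsUniformizing

variable {ϖ : K} (h : IsUniformizing ϖ)
include h

theorem valuation_pos : 0 < valuation K ϖ := zero_lt_iff.2 ((Valuation.ne_zero_iff _).2 h.ne_zero)

theorem valuation_pow_le_one (n : ℕ) : valuation K (ϖ ^ n) ≤ 1 := by
  rw [map_pow]
  exact pow_le_one' h.lt_one.le n

/-- If the two representatives differ by the factor `x`, then `x` is integral because the first lies
in the base lattice. Determinants give `ϖ ^ n` the valuation of `x² ϖ ^ m`, so `m ≤ n`. -/
theorem level_le {e₀ f₀ : Fin 2 → K} (hdet : pairDet e₀ f₀ ≠ 0) {v : BTVertex K} {n m : ℕ}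
    (hn : HasLevel ϖ e₀ f₀ v n) (hm : HasLevel ϖ e₀ f₀ v m) : m ≤ n := by
  obtain ⟨e, f, h1, h2⟩ := hn
  obtain ⟨e', f', h1', h2'⟩ := hm
  obtain ⟨x, hx, heq⟩ := (h2.eq_iff h2').1 rfl
  have hdet' := pairDet_ne_zero_of_pairSpan_eq h1' hdet
  have d1 := valuation_pairDet_eq h1 hdet
  have d2 := valuation_pairDet_eq h1' hdet
  have hx1 : valuation K x ≤ 1 := by
    have e1 : x • e' ∈ pairSpan e (ϖ ^ n • f) := heq ▸ left_mem_pairSpan _ _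
    have e2 : pairSpan e (ϖ ^ n • f) ≤ pairSpan e' f' := by
      rw [h1', ← h1, pairSpan_le_iff]
      exact ⟨left_mem_pairSpan _ _,
        smul_mem_of_valuation_le _ (h.valuation_pow_le_one n) (right_mem_pairSpan _ _)⟩
    have e3 := e2 e1
    rw [show x • e' = x • e' + (0 : K) • f' by simp, combination_mem_pairSpan_iff hdet'] at e3
    exact e3.1
  have hne : pairDet (x • e') (x • ϖ ^ m • f') ≠ 0 := by
    rw [smul_smul, pairDet_smul_smul]
    exact mul_ne_zero (mul_ne_zero hx (mul_ne_zero hx (pow_ne_zero _ h.ne_zero))) hdet'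
  have d3 := valuation_pairDet_eq heq hne
  have e4 : pairDet e (ϖ ^ n • f) = ϖ ^ n * pairDet e f := by
    simpa using pairDet_smul_smul e f 1 (ϖ ^ n)
  rw [e4, smul_smul, pairDet_smul_smul, map_mul, map_mul _ _ (pairDet e' f'), d1, d2] at d3
  have d4 := mul_right_cancel₀ ((Valuation.ne_zero_iff _).2 hdet) d3
  by_contra! hlt
  have d5 : valuation K (x * (x * ϖ ^ m)) ≤ valuation K (ϖ ^ m) := by
    rw [map_mul, map_mul]
    exact (mul_le_of_le_one_left' hx1).trans (mul_le_of_le_one_left' hx1)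
  rw [← d4, map_pow, map_pow] at d5
  exact (pow_right_strictAnti₀ h.valuation_pos h.lt_one hlt).not_ge d5

theorem level_unique {e₀ f₀ : Fin 2 → K} (hdet : pairDet e₀ f₀ ≠ 0) {v : BTVertex K} {n m : ℕ}
    (hn : HasLevel ϖ e₀ f₀ v n) (hm : HasLevel ϖ e₀ f₀ v m) : n = m :=
  le_antisymm (h.level_le hdet hm hn) (h.level_le hdet hn hm)

/-- Elementary divisors with `a` as pivot: after scaling by `a⁻¹` and clearing with integral
operations, the remaining entry `δ` is a unit times `ϖ ^ n`. -/
theorem exists_level_of_dominant {e₀ f₀ : Fin 2 → K} {v : BTVertex K} {a b c d : K}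
    (hb : valuation K b ≤ valuation K a) (hc : valuation K c ≤ valuation K a)
    (hd : valuation K d ≤ valuation K a) (hdet : a * d - b * c ≠ 0)
    (hv : Represents (a • e₀ + b • f₀) (c • e₀ + d • f₀) v) : ∃ n, HasLevel ϖ e₀ f₀ v n := by
  have ha : a ≠ 0 := by
    rintro rfl
    rw [map_zero, le_zero_iff, Valuation.zero_iff] at hb
    simp [hb] at hdet
  have hdiv : ∀ {y : K}, valuation K y ≤ valuation K a → valuation K (y / a) ≤ 1 := by
    intro y hy
    rw [map_div₀]
    exact div_le_one_of_le₀ hy zero_le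
  set δ := d / a - (c / a) * (b / a) with hδ
  have hδ0 : δ ≠ 0 := by
    intro h0
    apply hdet
    rw [hδ] at h0
    field_simp at h0
    linear_combination h0
  obtain ⟨n, hn⟩ := h.exists_pow δ hδ0
    (by simpa [hδ] using
      valuation_combination_le (hdiv hd) (b := (1 : K)) (by simp) (hdiv hc) (hdiv hb))
  have hpow : ϖ ^ n ≠ 0 := pow_ne_zero _ h.ne_zero
  refine ⟨n, e₀ + (b / a) • f₀, f₀, ?_, ?_⟩
  · have := pairSpan_combination e₀ f₀ (a := 1) (b := b / a) (c := 0) (d := 1) (by simp)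
      (hdiv hb) (by simp) (by simp) (by simp)
    simpa using this
  · refine (hv.smul (inv_ne_zero ha)).congr ?_
    have e1 : a⁻¹ • (a • e₀ + b • f₀) =
        (1 : K) • (e₀ + (b / a) • f₀) + (0 : K) • (ϖ ^ n • f₀) := by
      ext i
      simp
      field_simp
    have e2 : a⁻¹ • (c • e₀ + d • f₀) =
        (c / a) • (e₀ + (b / a) • f₀) + (δ / ϖ ^ n) • (ϖ ^ n • f₀) := by
      rw [smul_smul, div_mul_cancel₀ _ hpow, hδ]
      ext i
      simp
      field_simp
      ring
    have hunit : valuation K (δ / ϖ ^ n) = 1 := by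
      rw [map_div₀, hn, map_pow, div_self (pow_ne_zero _ h.valuation_pos.ne')]
    rw [e1, e2, pairSpan_combination _ _ (by simp) (by simp) (hdiv hc) hunit.le
      (by rwa [one_mul, zero_mul, sub_zero])]

theorem exists_level [IsDiscreteValuationRing 𝒪[K]] {e₀ f₀ : Fin 2 → K}
    (hdet : pairDet e₀ f₀ ≠ 0) (v : BTVertex K) : ∃ n, HasLevel ϖ e₀ f₀ v n := by
  obtain ⟨u, w, huw, hv⟩ := exists_represents_vertex v
  obtain ⟨a, b, rfl⟩ := exists_combination hdet u
  obtain ⟨c, d, rfl⟩ := exists_combination hdet w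
  rw [pairDet_combination] at huw
  have hne := left_ne_zero_of_mul huw
  -- Exchanging the vectors of either basis brings the largest of the four coefficients into the
  -- place of the pivot.
  have hmax : ∀ x y z t : ValueGroupWithZero K, (y ≤ x ∧ z ≤ x ∧ t ≤ x) ∨
      (x ≤ y ∧ z ≤ y ∧ t ≤ y) ∨ (x ≤ z ∧ y ≤ z ∧ t ≤ z) ∨ (x ≤ t ∧ y ≤ t ∧ z ≤ t) := by
    intro x y z t
    grind
  have hcomm := pairSpan_comm f₀ e₀
  have hv' := hv.congr (pairSpan_comm (c • e₀ + d • f₀) (a • e₀ + b • f₀))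
  rcases hmax (valuation K a) (valuation K b) (valuation K c) (valuation K d) with
    ⟨h1, h2, h3⟩ | ⟨h1, h2, h3⟩ | ⟨h1, h2, h3⟩ | ⟨h1, h2, h3⟩
  · exact h.exists_level_of_dominant h1 h2 h3 hne hv
  · rw [add_comm (a • e₀), add_comm (c • e₀)] at hv
    obtain ⟨n, hn⟩ := h.exists_level_of_dominant h1 h3 h2
      (by contrapose! hne; linear_combination -hne) hv
    exact ⟨n, hn.congr hcomm⟩
  · exact h.exists_level_of_dominant h3 h1 h2 (by contrapose! hne; linear_combination -hne) hv'
  · rw [add_comm (a • e₀), add_comm (c • e₀)] at hv'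
    obtain ⟨n, hn⟩ := h.exists_level_of_dominant h3 h2 h1
      (by contrapose! hne; linear_combination hne) hv'
    exact ⟨n, hn.congr hcomm⟩

/-- Let `g = ϖ ^ n f`. A neighbour is determined by a primitive vector `a e + b g`. If `a` is a
unit, `e` can be replaced by `e + (b / a) g` and the level rises; otherwise the neighbour is the
single class of `(ϖ e, g)`. -/
theorem level_of_adj [IsDiscreteValuationRing 𝒪[K]] {e f : Fin 2 → K}
    (hdet : pairDet e f ≠ 0) {v w : BTVertex K} {n : ℕ} (hv : Represents e (ϖ ^ n • f) v)
    (hvw : (bruhatTitsTree K).Adj v w) :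
    HasLevel ϖ e f w (n + 1) ∨ Represents (ϖ • e) (ϖ ^ n • f) w := by
  obtain ⟨p, q, -, hpq, hw⟩ := (h.adj_iff v w).1 hvw
  obtain ⟨x, hx, heq⟩ := (hv.eq_iff hpq).1 rfl
  have hdet' : pairDet e (ϖ ^ n • f) ≠ 0 := by
    have := pairDet_smul_smul e f 1 (ϖ ^ n)
    rw [one_smul] at this
    rw [this]
    exact mul_ne_zero (mul_ne_zero one_ne_zero (pow_ne_zero _ h.ne_zero)) hdet
  have hw' := hw.smul hx
  rw [smul_comm x ϖ q] at hw'
  obtain ⟨a, b, c, d, ha, hb, hc, hd, h1, h2, hu⟩ := exists_of_pairSpan_eq heq.symm hdet'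
  rw [h1, h2] at hw'
  set g := ϖ ^ n • f with hg
  rcases ha.lt_or_eq with ha1 | ha1
  · right
    obtain ⟨a', ha', rfl⟩ := h.exists_eq_mul ha1
    refine hw'.congr ?_
    rw [show (ϖ * a') • e + b • g = a' • (ϖ • e) + b • g by module,
      show ϖ • (c • e + d • g) = c • (ϖ • e) + (ϖ * d) • g by module]
    refine (pairSpan_combination _ _ ha' hb hc ?_ ?_).symm
    · rw [map_mul]
      exact mul_le_one' h.lt_one.le hd
    · rwa [show a' * (ϖ * d) - b * c = ϖ * a' * d - b * c by ring]
  · left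
    have ha0 : a ≠ 0 := by
      rintro rfl
      simp at ha1
    have hba : valuation K (b / a) ≤ 1 := by rwa [map_div₀, ha1, div_one]
    refine ⟨e + (b / a) • g, f, ?_, hw'.congr ?_⟩
    · have := pairSpan_combination e f (a := 1) (b := b / a * ϖ ^ n) (c := 0) (d := 1) (by simp)
        (by rw [map_mul]; exact mul_le_one' hba (h.valuation_pow_le_one n))
        (by simp) (by simp) (by simp)
      simpa [hg, smul_smul] using this
    · have e1 : a • e + b • g = a • (e + (b / a) • g) + (0 : K) • (ϖ • g) := by
        rw [smul_add, smul_smul a (b / a) g, mul_div_cancel₀ _ ha0, zero_smul, add_zero]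
      have e2 : ϖ • (c • e + d • g) =
          (ϖ * c) • (e + (b / a) • g) + (d - c * (b / a)) • (ϖ • g) := by module
      have e3 : ϖ ^ (n + 1) • f = ϖ • g := by rw [hg, smul_smul, pow_succ']
      rw [e1, e2, e3]
      refine (pairSpan_combination _ _ ha (by simp) ?_ ?_ ?_).symm
      · rw [map_mul]
        exact mul_le_one' h.lt_one.le hc
      · simpa using valuation_combination_le hd (b := (1 : K)) (by simp) hc hba
      · rw [← hu]
        congr 1
        field_simp
        ring

theorem isMetricTree [IsDiscreteValuationRing 𝒪[K]] : IsMetricTree (bruhatTitsTree K) := by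
  choose e f hdet hrep using exists_represents_vertex (K := K)
  choose δ hδ using fun x => h.exists_level (hdet x)
  have huniq : ∀ {x v n}, HasLevel ϖ (e x) (f x) v n → δ x v = n :=
    fun {x v n} hn => h.level_unique (hdet x) (hδ x v) hn
  have : Nonempty (BTVertex K) := by
    obtain ⟨v, -⟩ := exists_represents (K := K) (e := Pi.single 0 1) (f := Pi.single 1 1)
      (by simp [pairDet])
    exact ⟨v⟩
  refine isMetricTree_of_levels δ (fun x v => ⟨fun h0 => ?_, ?_⟩) (fun x v hxv => ?_)
    (fun x v n hn => ?_)
  · obtain ⟨e', f', h1, h2⟩ := hδ x v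
    rw [h0, pow_zero, one_smul] at h2
    exact (h2.congr h1.symm).unique (hrep x)
  · rintro rfl
    exact huniq ⟨_, _, rfl, by simpa using hrep v⟩
  · apply huniq
    -- At level zero the exceptional neighbour `(ϖ e, f)` also has level one, with the basis vectors
    -- exchanged.
    rcases h.level_of_adj (hdet x) (n := 0) (by simpa using hrep x) hxv with h1 | h1
    · exact h1
    · rw [pow_zero, one_smul] at h1
      exact ⟨f x, e x, pairSpan_comm _ _, by
        rw [pow_one]; exact h1.congr (pairSpan_comm _ _)⟩
  · obtain ⟨e', f', h1, h2⟩ := hδ x v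
    rw [hn] at h2
    have hdet' := pairDet_ne_zero_of_pairSpan_eq h1 (hdet x)
    have hdet2 : pairDet e' (ϖ ^ n • f') ≠ 0 := by
      have := pairDet_smul_smul e' f' 1 (ϖ ^ n)
      rw [one_smul] at this
      rw [this]
      exact mul_ne_zero (mul_ne_zero one_ne_zero (pow_ne_zero _ h.ne_zero)) hdet'
    obtain ⟨u, hu⟩ := exists_represents hdet2
    have hsucc : ϖ ^ (n + 1) • f' = ϖ • ϖ ^ n • f' := by rw [smul_smul, pow_succ']
    refine ⟨u, ?_, huniq ⟨e', f', h1, hu⟩, fun w hw => ?_⟩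
    · refine ((h.adj_iff u v).2 ⟨e', ϖ ^ n • f', hdet2, hu, ?_⟩).symm
      rwa [← hsucc]
    · rcases h.level_of_adj hdet' h2 hw with h3 | h3
      · exact .inl (huniq (h3.congr h1))
      · right
        rw [hsucc] at h3
        have h4 := h3.smul (inv_ne_zero h.ne_zero)
        rw [inv_smul_smul₀ h.ne_zero, inv_smul_smul₀ h.ne_zero] at h4
        exact h4.unique hu

end IsUniformizing

end BruhatTitsLevels

/-! ### The action of `SL₂(K)` and its discrete subgroups -/

section BruhatTitsAction

open ValuativeRel Matrix

variable {K : Type*} [Field K]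

theorem pairDet_mulVec (g : SpecialLinearGroup (Fin 2) K) (e f : Fin 2 → K) :
    pairDet (g.1 *ᵥ e) (g.1 *ᵥ f) = pairDet e f := by
  have hg := g.2
  rw [det_fin_two] at hg
  simp only [pairDet, mulVec, dotProduct, Fin.sum_univ_two]
  linear_combination (e 0 * f 1 - e 1 * f 0) * hg

variable [ValuativeRel K]

theorem Represents.specialLinearGroup_smul {e f : Fin 2 → K} {v : BTVertex K}
    (h : Represents e f v) (g : SpecialLinearGroup (Fin 2) K) :
    Represents (g.1 *ᵥ e) (g.1 *ᵥ f) (g • v) := by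
  obtain ⟨L, rfl, hL⟩ := h
  refine ⟨latticeMap g L, rfl, ?_⟩
  change L.1.map _ = _
  rw [hL, pairSpan, Submodule.map_span, Set.image_pair]
  rfl

theorem IsUniformizing.actsByIsometries [IsDiscreteValuationRing 𝒪[K]] {ϖ : K}
    (h : IsUniformizing ϖ) :
    ActsByIsometries (bruhatTitsTree K) (SpecialLinearGroup (Fin 2) K) := by
  refine .of_adj h.isMetricTree.connected fun g u v huv => ?_
  obtain ⟨e, f, hdet, hu, hv⟩ := (h.adj_iff u v).1 huv
  refine (h.adj_iff _ _).2 ⟨_, _, ?_, hu.specialLinearGroup_smul g, ?_⟩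
  · rwa [pairDet_mulVec]
  · rw [← mulVec_smul]
    exact hv.specialLinearGroup_smul g

/-- An element of `SL₂(K)` that fixes the class of a lattice has integral matrix entries with
respect to a basis of this lattice. -/
theorem exists_integral_matrix {e f : Fin 2 → K} (hdet : pairDet e f ≠ 0) {v : BTVertex K}
    (hv : Represents e f v) {g : SpecialLinearGroup (Fin 2) K} (hg : g • v = v) :
    ∃ N : Matrix (Fin 2) (Fin 2) K, (∀ i j, valuation K (N i j) ≤ 1) ∧
      g.1 = (Matrix.of ![e, f])ᵀ * N * ((Matrix.of ![e, f])ᵀ)⁻¹ := by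
  obtain ⟨x, hx, heq⟩ := ((hv.specialLinearGroup_smul g).eq_iff hv).1 hg
  have hdet' : pairDet (x • e) (x • f) ≠ 0 := by
    rw [pairDet_smul_smul]
    exact mul_ne_zero (mul_ne_zero hx hx) hdet
  have h1 := valuation_pairDet_eq heq hdet'
  rw [pairDet_mulVec, pairDet_smul_smul, map_mul, map_mul] at h1
  -- Since `g` has determinant one, the factor `x` has valuation one, so `g` preserves the lattice
  -- itself.
  have h2 : valuation K x * valuation K x = 1 :=
    (mul_right_cancel₀ ((Valuation.ne_zero_iff _).2 hdet) (by rw [one_mul, ← h1])).symm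
  have hx1 : valuation K x ≤ 1 := by
    by_contra! hlt
    exact (one_lt_mul'' hlt hlt).ne' h2
  obtain ⟨a, b, c, d, ha, hb, hc, hd, e1, e2, -⟩ := exists_of_pairSpan_eq heq hdet'
  have hmul : ∀ {y : K}, valuation K y ≤ 1 → valuation K (y * x) ≤ 1 := by
    intro y hy
    rw [map_mul]
    exact mul_le_one' hy hx1
  refine ⟨!![a * x, c * x; b * x, d * x], ?_, ?_⟩
  · intro i j
    fin_cases i <;> fin_cases j
    · exact hmul ha
    · exact hmul hc
    · exact hmul hb
    · exact hmul hd
  · have hunit : IsUnit ((Matrix.of ![e, f])ᵀ).det := by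
      rw [isUnit_iff_ne_zero, det_transpose, det_fin_two]
      simpa [pairDet] using hdet
    rw [← mul_nonsing_inv_cancel_right _ g.1 hunit]
    congr 1
    ext i j
    have f1 := congrFun e1 i
    have f2 := congrFun e2 i
    simp only [mulVec, dotProduct, Fin.sum_univ_two, Pi.add_apply, Pi.smul_apply,
      smul_eq_mul] at f1 f2
    fin_cases j
    · simp [Matrix.mul_apply, Fin.sum_univ_two]
      linear_combination f1
    · simp [Matrix.mul_apply, Fin.sum_univ_two]
      linear_combination f2

/-- The stabiliser lies in a conjugate of the compact set of integral matrices. A discrete subgroup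
of a Hausdorff group is closed, and it meets a compact set in a finite set. -/
theorem finite_stabilizer_of_discrete [TopologicalSpace K] [IsNonarchimedeanLocalField K]
    (G : Subgroup (SpecialLinearGroup (Fin 2) K)) [DiscreteTopology G] (v : BTVertex K) :
    {g : SpecialLinearGroup (Fin 2) K | g ∈ G ∧ g • v = v}.Finite := by
  obtain ⟨e, f, hdet, hv⟩ := exists_represents_vertex v
  have : T2Space K := by
    let := IsTopologicalAddGroup.rightUniformSpace K
    have := isUniformAddGroup_of_addCommGroup (G := K)
    have : T0Space K := ValuedRing.separated (Γ₀ := ValueGroupWithZero K)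
    infer_instance
  have : T2Space (SpecialLinearGroup (Fin 2) K) :=
    SpecialLinearGroup.isClosedEmbedding_val.isEmbedding.t2Space
  have hC : IsCompact {N : Matrix (Fin 2) (Fin 2) K | ∀ i j, valuation K (N i j) ≤ 1} := by
    have := isCompact_univ_pi fun _ : Fin 2 => isCompact_univ_pi fun _ : Fin 2 =>
      IsNonarchimedeanLocalField.isCompact_closedBall K 1
    convert! this using 1
    ext N
    exact ⟨fun h i _ j _ => h i j, fun h i j => h i trivial j trivial⟩
  have hC' := hC.image (f := fun N => (Matrix.of ![e, f])ᵀ * N * ((Matrix.of ![e, f])ᵀ)⁻¹)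
    (by fun_prop)
  have hG : IsClosed (G : Set (SpecialLinearGroup (Fin 2) K)) := Subgroup.isClosed_of_discrete
  have hfin := isCompact_iff_finite.1 (hG.isClosedEmbedding_subtypeVal.isCompact_preimage
    (SpecialLinearGroup.isClosedEmbedding_val.isCompact_preimage hC'))
  refine (hfin.image Subtype.val).subset ?_
  rintro g ⟨hg, hgv⟩
  obtain ⟨N, hN, hgN⟩ := exists_integral_matrix hdet hv hgv
  exact ⟨⟨g, hg⟩, ⟨N, hN, hgN.symm⟩, rfl⟩

end BruhatTitsAction

theorem mainTheorem7 :
    (∀ (K : Type*) [Field K] [ValuativeRel K] [TopologicalSpace K] [IsNonarchimedeanLocalField K]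
        (A B : Matrix.SpecialLinearGroup (Fin 2) K),
      DiscreteTopology (Subgroup.closure {A, B}) →
      IsFreeOfRankTwo (Subgroup.closure {A, B}) →
      ∀ C : Matrix.SpecialLinearGroup (Fin 2) K,
        TerminatesCorrectly (bruhatTitsTree K) A B C) ∧
    (∀ (V : Type*) (T : SimpleGraph V), T.IsTree → (∀ v : V, (T.neighborSet v).Finite) →
      ∀ A B : T ≃g T,
      IsPointwiseDiscrete (Subgroup.closure {A, B}) →
      IsFreeOfRankTwo (Subgroup.closure {A, B}) →
      ∀ C : T ≃g T, TerminatesCorrectly T A B C) := by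
  refine ⟨fun K _ _ _ _ A B hdisc hfree C => ?_, fun V T hT hfin A B hdisc hfree C => ?_⟩
  · obtain ⟨ϖ, hp⟩ := exists_uniformizing (K := K)
    exact (hfree.actsFreely hp.isMetricTree hp.actsByIsometries
      (finite_stabilizer_of_discrete _)).terminatesCorrectly C
  · have hT' := hT.isMetricTree
    exact (hfree.actsFreely hT' (actsByIsometries_automorphisms hT'.connected)
      (hdisc.finite_stabilizer hT' hfin)).terminatesCorrectly C
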